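/- Let $G$ be a context-free grammar in Chomsky normal form, viewed as a DAG with $n$ nodes (the symbols $X_1,\dots,X_n$; those without a production stand for terminals) in which every production $Z\to XY$ gives $Z$ the left child $X$ and the right child $Y$, and different symbols have different right-hand sides. Add a node $v$ that is both the left and the right child of every sink, and let $T_L$ (resp. $T_R$) be the tree rooted at $v$ in which the parent of a node is its left (resp. right) child in the DAG. Suppose that the symbols are numbered level by level (level = depth in $T_L$), the symbols of one level with productions $Z\to XY$ being ranked by the lexicographic order of the pairs $(X,Y)$. Let $k\ge 1$ be the maximum number of children of a node of $T_L$; it is at most $n$. (All logarithms are to base 2.) Let $0<\varepsilon<1$. On a word RAM with $\Theta(\log n)$-bit words, consider $G$ stored as the LOUDS bit strings of $T_L$ and $T_R$ and the array $P$ that sends the level-order number of a node in $T_L$ to its level-order number in $T_R$, together with an auxiliary index, in $(1+\varepsilon)n\log n+4n+o(n)$ bits in total (where $\varepsilon$ is fixed as $n\to\infty$). The auxiliary index can be chosen such that the reverse dictionary, i.e. the partial function $f(XY)=Z$ for the productions $Z\to XY$, is computable (including the detection that $f(XY)$ is undefined) from this representation, by one fixed program for all $G$ and $\varepsilon$, in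 time $$O\!\left(\tfrac1\varepsilon\log (k+1)\right)=O\!\left(\tfrac1\varepsilon\log (n+1)\right),$$ with constants that depend neither on $G$ nor on $\varepsilon$. -/

import Mathlib

namespace ESPIndex

/-! ## Ordered trees and their LOUDS bit strings -/

section OrderedTree

variable {V : Type*}

/-- The nodes at depth `h` of the ordered tree with the given root and ordered lists of children,
from left to right. -/
def levelList (children : V → List V) (root : V) : ℕ → List V
  | 0 => [root]
  | h + 1 => (levelList children root h).flatMap children

/-- The level-order sequence of the nodes of an ordered tree that has at most `N` nodes (such a
tree has no node at depth `N` or deeper). -/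
def levelOrder (children : V → List V) (root : V) (N : ℕ) : List V :=
  (List.range N).flatMap (levelList children root)

/-- The LOUDS bit string: the prefix `10`, followed by `1^d 0` for every node in level order,
where `d` is the number of children of the node. -/
def louds (children : V → List V) (root : V) (N : ℕ) : List Bool :=
  [true, false] ++
    (levelOrder children root N).flatMap
      fun v => List.replicate (children v).length true ++ [false]

end OrderedTree

/-! ## Grammars in Chomsky normal form -/

/-- A context-free grammar in Chomsky normal form (a straight-line grammar), as a DAG whose nodes
are the `n` symbols. `rule Z = some (X, Y)` is the production `Z → X Y`; `rule Z = none` says that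
`Z` is a sink of the DAG, i.e. stands for a terminal. -/
structure Grammar (n : ℕ) where
  /-- The production of a symbol. -/
  rule : Fin n → Option (Fin n × Fin n)
  /-- The graph of the productions has no cycle. -/
  acyclic : WellFounded fun c Z : Fin n => ∃ p, rule Z = some p ∧ (c = p.1 ∨ c = p.2)
  /-- Different symbols have different right-hand sides. -/
  rule_inj : ∀ Z Z' p, rule Z = some p → rule Z' = some p → Z = Z'

namespace Grammar

variable {n : ℕ} (G : Grammar n)

/-- The dictionary in the reverse direction: the symbol `Z` with `Z → X Y`, if there is one. -/
def reverseDict (X Y : Fin n) : Option (Fin n) :=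
  (List.finRange n).find? fun Z => decide (G.rule Z = some (X, Y))

/-- The node of a symbol in the trees below. Their nodes are the `n` symbols, the symbol number `i`
being `i + 1`, and the additional sink `0` that every sink of the DAG gets as its left and as
its right child. -/
def node (Z : Fin n) : Fin (n + 1) := Z.succ

/-- The left child of a symbol in the DAG, which is its parent in the left tree. -/
def leftParent (Z : Fin n) : Fin (n + 1) :=
  match G.rule Z with
  | none => 0
  | some p => node p.1

/-- The right child of a symbol in the DAG, which is its parent in the right tree. -/
def rightParent (Z : Fin n) : Fin (n + 1) :=
  match G.rule Z with
  | none => 0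
  | some p => node p.2

/-- The children of a node in the left tree `T_L`, in the order of their names. -/
def leftChildren (v : Fin (n + 1)) : List (Fin (n + 1)) :=
  ((List.finRange n).filter fun Z => decide (G.leftParent Z = v)).map node

/-- The children of a node in the right tree `T_R`, in the order of their names. -/
def rightChildren (v : Fin (n + 1)) : List (Fin (n + 1)) :=
  ((List.finRange n).filter fun Z => decide (G.rightParent Z = v)).map node

/-- The maximum degree (number of children of a node) of `T_L`. -/
def maxDegree : ℕ := Finset.univ.sup fun v => (G.leftChildren v).length

/-- The symbol `Z` is in level `h`, i.e. at depth `h` of `T_L`. -/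
def InLevel (h : ℕ) (Z : Fin n) : Prop := node Z ∈ levelList G.leftChildren 0 h

/-- The names of the symbols are the ones given by the preprocessing: the symbols are numbered
level by level, and within a level the symbols with productions `Z → X Y` are numbered by the rank
of the pair `(X, Y)` in the lexicographic order. -/
def SortedNames : Prop :=
  (∀ h h' Z Z', G.InLevel h Z → G.InLevel h' Z' → h < h' → Z < Z') ∧
  (∀ h Z Z' X Y X' Y', G.InLevel h Z → G.InLevel h Z' →
    G.rule Z = some (X, Y) → G.rule Z' = some (X', Y') →
    (X < X' ∨ (X = X' ∧ Y < Y')) → Z < Z')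

/-- The array `P`: its `i`-th entry is the level-order number in `T_R` of the node that has the
level-order number `i` in `T_L`. -/
def perm : List ℕ :=
  (levelOrder G.leftChildren 0 (n + 1)).map
    fun v => (levelOrder G.rightChildren 0 (n + 1)).idxOf v

end Grammar

/-- The `b` low-order bits of a number, the least significant one first. -/
def toBits (b x : ℕ) : List Bool := (List.range b).map x.testBit

/-- The compact representation of a grammar: the LOUDS bit strings of `T_L` and `T_R` and the array
`P`, whose entries are numbers `≤ n` and take `⌈log₂ (n + 1)⌉` bits each. -/
def Grammar.representation {n : ℕ} (G : Grammar n) : List Bool :=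
  louds G.leftChildren 0 (n + 1) ++ louds G.rightChildren 0 (n + 1) ++
    G.perm.flatMap (toBits (Nat.size n))

/-! ## A word RAM -/

/-- The arithmetical and logical operations on words. -/
inductive Op
  | add | sub | mul | div | mod | shl | shr | and | or | xor

/-- The value of an operation on natural numbers (difference truncated, division by `0` gives
`0`). -/
def Op.eval : Op → ℕ → ℕ → ℕ
  | .add, x, y => x + y
  | .sub, x, y => x - y
  | .mul, x, y => x * y
  | .div, x, y => x / y
  | .mod, x, y => x % y
  | .shl, x, y => x <<< y
  | .shr, x, y => x >>> y
  | .and, x, y => x &&& y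
  | .or, x, y => x ||| y
  | .xor, x, y => x ^^^ y

/-- Programs of a word RAM with read-only memory. Registers are named by natural numbers; a program
mentions only finitely many of them. -/
inductive Prog
  /-- do nothing -/
  | skip
  /-- register `d` gets the constant `c` -/
  | const (d c : ℕ)
  /-- register `d` gets the value of the operation on registers `x` and `y` -/
  | op (o : Op) (d x y : ℕ)
  /-- register `d` gets the word that starts at the bit address in register `x` -/
  | load (d x : ℕ)
  /-- sequential composition -/
  | seq (p q : Prog)
  /-- if register `x` is less than register `y` then `p` else `q` -/
  | ite (x y : ℕ) (p q : Prog)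
  /-- while register `x` is less than register `y` do `p` -/
  | loop (x y : ℕ) (p : Prog)

/-- The word of `w` consecutive bits that starts at bit address `a` (memory is zero beyond its
end). -/
def readWord (w : ℕ) (mem : List Bool) (a : ℕ) : ℕ :=
  ∑ j ∈ Finset.range w, if mem.getD (a + j) false then 2 ^ j else 0

/-- `Exec w mem p s t s'`: on a machine with word length `w` and memory `mem`, the program `p`
started with register contents `s` halts after `t` steps with register contents `s'`. Every
instruction and every evaluation of a test is one step. -/
inductive Exec (w : ℕ) (mem : List Bool) : Prog → (ℕ → ℕ) → ℕ → (ℕ → ℕ) → Prop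
  | skip (s : ℕ → ℕ) : Exec w mem .skip s 1 s
  | const (s : ℕ → ℕ) (d c : ℕ) :
      Exec w mem (.const d c) s 1 (Function.update s d (c % 2 ^ w))
  | op (s : ℕ → ℕ) (o : Op) (d x y : ℕ) :
      Exec w mem (.op o d x y) s 1 (Function.update s d (o.eval (s x) (s y) % 2 ^ w))
  | load (s : ℕ → ℕ) (d x : ℕ) :
      Exec w mem (.load d x) s 1 (Function.update s d (readWord w mem (s x)))
  | seq {p q : Prog} {s s' s'' : ℕ → ℕ} {t t' : ℕ} :
      Exec w mem p s t s' → Exec w mem q s' t' s'' → Exec w mem (.seq p q) s (t + t') s''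
  | ite_true {p q : Prog} {s s' : ℕ → ℕ} {t x y : ℕ} :
      s x < s y → Exec w mem p s t s' → Exec w mem (.ite x y p q) s (t + 1) s'
  | ite_false {p q : Prog} {s s' : ℕ → ℕ} {t x y : ℕ} :
      ¬ s x < s y → Exec w mem q s t s' → Exec w mem (.ite x y p q) s (t + 1) s'
  | loop_true {p : Prog} {s s' s'' : ℕ → ℕ} {t t' x y : ℕ} :
      s x < s y → Exec w mem p s t s' → Exec w mem (.loop x y p) s' t' s'' →
      Exec w mem (.loop x y p) s (t + 1 + t') s''
  | loop_false {p : Prog} {s : ℕ → ℕ} {x y : ℕ} :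
      ¬ s x < s y → Exec w mem (.loop x y p) s 1 s

/-- The register contents that hold the query `(x, y)`: `x` in register `0`, `y` in register `1`,
and zero in all other registers. -/
def queryState (x y : ℕ) : ℕ → ℕ := fun r => if r = 0 then x else if r = 1 then y else 0

/-- The answer to a query as a number: the node number of `Z`, or `0` (the number of the additional
sink, which has no production) if no symbol is defined. -/
def answer {n : ℕ} : Option (Fin n) → ℕ
  | none => 0
  | some Z => (Grammar.node Z : ℕ)

end ESPIndex

/-!
The right-hand side of a production `Z → X Y` is determined by the parents `X` and `Y` of `Z` in the
two trees. The naming of the symbols makes the names the level-order numbers in `T_L`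
(`Grammar.SortedNames.order_eq`). In the level order of any tree the parents are monotone
(`idxOf_parentOf_mono`), so the children of a block of consecutive nodes form an interval, and the
pairs `(X, Y)` increase lexicographically with `Z` (`IsForestPair.key_mono`).

The index samples every `s`-th node, where `s` is of order `1 / ε`. For every sample it stores the
start of its interval of children in both trees, and its pair `(X, Y)` as one number, its key. In
addition it stores for every node its parent modulo `s`, in both trees. The samples take
`O((n / s) log n)` bits and the residues `O(n log s)` bits, so that for large `n` all of this,
together with the rounding of `log n` in the array `P`, is below `ε n log n` (`memLength_le`).

A query `(X, Y)` reads the interval of the children of the block of `X` in `T_L`, which contains at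
most `s k + 1` nodes and hence about `k` samples. A binary search on the keys leaves `s` candidates
(`runs_searchStep`). A candidate `Z` is tested for the left parent `X` by its residue, since its
position already tells the block, and for the right parent `Y` in the same way, at its position
`P[Z]` in the level order of `T_R`, where the parent has to be the node number `P[Y]` (`runs_test`).
No inverse of `P` is needed for this. The time is `O(log (k + 1) + 1 / ε)` (`runs_queryProg`).
-/

namespace ESPIndex

/-! ### Trees given by a parent function, and their level order -/

section Tree

variable {n : ℕ} {q : Fin n → Fin (n + 1)}

/-- The children lists of the tree on the nodes `0, …, n` in which the node `Z + 1` has the parent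
`q Z` and `0` is the root; siblings are ordered by their names. -/
def childrenOf (q : Fin n → Fin (n + 1)) (v : Fin (n + 1)) : List (Fin (n + 1)) :=
  ((List.finRange n).filter fun Z => decide (q Z = v)).map Fin.succ

/-- The parent of a node; the root is made its own parent. -/
def parentOf (q : Fin n → Fin (n + 1)) : Fin (n + 1) → Fin (n + 1) := Fin.cases 0 q

@[simp] lemma parentOf_zero : parentOf q 0 = 0 := rfl

@[simp] lemma parentOf_succ (Z : Fin n) : parentOf q Z.succ = q Z := rfl

lemma mem_childrenOf {v u : Fin (n + 1)} :
    u ∈ childrenOf q v ↔ ∃ Z : Fin n, q Z = v ∧ Z.succ = u := by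
  simp [childrenOf]

lemma pairwise_childrenOf (v : Fin (n + 1)) : (childrenOf q v).Pairwise (· < ·) := by
  rw [childrenOf, List.pairwise_map]
  refine List.Pairwise.filter _ ?_
  simpa using (List.pairwise_lt_finRange n)

lemma parentOf_of_mem_childrenOf {v u : Fin (n + 1)} (h : u ∈ childrenOf q v) :
    parentOf q u = v := by
  obtain ⟨Z, rfl, rfl⟩ := mem_childrenOf.1 h
  rfl

lemma mem_level_succ {h : ℕ} {v : Fin (n + 1)} :
    v ∈ levelList (childrenOf q) 0 (h + 1) ↔
      ∃ Z : Fin n, Z.succ = v ∧ q Z ∈ levelList (childrenOf q) 0 h := by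
  simp only [levelList, List.mem_flatMap, mem_childrenOf]
  constructor
  · rintro ⟨u, hu, Z, rfl, rfl⟩
    exact ⟨Z, rfl, hu⟩
  · rintro ⟨Z, rfl, hu⟩
    exact ⟨_, hu, Z, rfl, rfl⟩

lemma zero_mem_level {h : ℕ} : (0 : Fin (n + 1)) ∈ levelList (childrenOf q) 0 h ↔ h = 0 := by
  cases h with
  | zero => simp [levelList]
  | succ h => simp [mem_level_succ, Fin.succ_ne_zero]

lemma level_unique {h h' : ℕ} {v : Fin (n + 1)} (hv : v ∈ levelList (childrenOf q) 0 h)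
    (hv' : v ∈ levelList (childrenOf q) 0 h') : h = h' := by
  induction h generalizing h' v with
  | zero =>
    obtain rfl : v = 0 := by simpa [levelList] using hv
    exact (zero_mem_level.1 hv').symm
  | succ h ih =>
    obtain ⟨Z, rfl, hZ⟩ := mem_level_succ.1 hv
    cases h' with
    | zero => simp [levelList, Fin.succ_ne_zero] at hv'
    | succ h' =>
      obtain ⟨Z', hZZ', hZ'⟩ := mem_level_succ.1 hv'
      obtain rfl := Fin.succ_injective _ hZZ'
      rw [ih hZ hZ']

/-- The levels up to a non-empty one are non-empty and disjoint, so there are at most `n + 1`. -/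
lemma level_le {h : ℕ} {v : Fin (n + 1)} (hv : v ∈ levelList (childrenOf q) 0 h) : h ≤ n := by
  have anc : ∀ i ≤ h, ∃ u, u ∈ levelList (childrenOf q) 0 i := by
    intro i hi
    induction h generalizing v with
    | zero =>
      obtain rfl : i = 0 := by omega
      exact ⟨v, hv⟩
    | succ h ih =>
      rcases hi.lt_or_eq with hlt | rfl
      · obtain ⟨Z, -, hZ⟩ := mem_level_succ.1 hv
        exact ih hZ (by omega)
      · exact ⟨v, hv⟩
  choose! f hf using anc
  have inj : Function.Injective fun i : Fin (h + 1) => f i := fun i j hij =>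
    Fin.ext (level_unique (hf i (by omega)) (by
      have : f i = f j := hij
      rw [this]; exact hf j (by omega)))
  have := Fintype.card_le_of_injective _ inj
  simp only [Fintype.card_fin] at this
  omega

lemma exists_level (hq : WellFounded fun c Z : Fin n => q Z = c.succ) (v : Fin (n + 1)) :
    ∃ h, v ∈ levelList (childrenOf q) 0 h := by
  refine Fin.cases ⟨0, by simp [levelList]⟩ (fun Z => ?_) v
  induction Z using hq.induction with
  | _ Z ih =>
    rcases Fin.eq_zero_or_eq_succ (q Z) with h0 | ⟨c, hc⟩
    · exact ⟨1, mem_level_succ.2 ⟨Z, rfl, by simp [h0, levelList]⟩⟩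
    · obtain ⟨h, hh⟩ := ih c hc
      exact ⟨h + 1, mem_level_succ.2 ⟨Z, rfl, hc ▸ hh⟩⟩

lemma nodup_level (h : ℕ) : (levelList (childrenOf q) 0 h).Nodup := by
  induction h with
  | zero => simp [levelList]
  | succ h ih =>
    rw [levelList, List.nodup_flatMap]
    refine ⟨fun v _ => (pairwise_childrenOf v).imp ne_of_lt, ih.imp fun {v v'} hne => ?_⟩
    intro u hu hu'
    exact hne ((parentOf_of_mem_childrenOf hu).symm.trans (parentOf_of_mem_childrenOf hu'))

/-- The level-order sequence of the nodes. -/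
def order (q : Fin n → Fin (n + 1)) : List (Fin (n + 1)) := levelOrder (childrenOf q) 0 (n + 1)

lemma nodup_order : (order q).Nodup := by
  rw [order, levelOrder, List.nodup_flatMap]
  refine ⟨fun h _ => nodup_level h, List.nodup_range.imp fun {h h'} hne => ?_⟩
  intro u hu hu'
  exact hne (level_unique hu hu')

lemma mem_order (hq : WellFounded fun c Z : Fin n => q Z = c.succ) (v : Fin (n + 1)) :
    v ∈ order q := by
  obtain ⟨h, hh⟩ := exists_level hq v
  exact List.mem_flatMap.2 ⟨h, by simpa using Nat.lt_succ_of_le (level_le hh), hh⟩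

lemma order_perm (hq : WellFounded fun c Z : Fin n => q Z = c.succ) :
    (order q).Perm (List.finRange (n + 1)) :=
  (List.perm_ext_iff_of_nodup nodup_order (List.nodup_finRange _)).2
    fun v => by simp [mem_order hq v]

/-- The level order lists the root and then the children of its own entries, one after the other:
the level after the last one is empty. -/
lemma order_eq_cons : order q = 0 :: (order q).flatMap (childrenOf q) := by
  have last : levelList (childrenOf q) 0 (n + 1) = [] := by
    rw [List.eq_nil_iff_forall_not_mem]
    intro v hv
    have := level_le hv
    omega
  have shift : (order q).flatMap (childrenOf q) =
      (List.range (n + 1)).flatMap fun h => levelList (childrenOf q) 0 (h + 1) := by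
    rw [order, levelOrder, List.flatMap_assoc]
    rfl
  have key : (List.range (n + 2)).flatMap (levelList (childrenOf q) 0) =
      0 :: (order q).flatMap (childrenOf q) := by
    rw [shift, List.range_succ_eq_map, List.flatMap_cons, List.flatMap_map]
    rfl
  rw [← key, List.range_succ, List.flatMap_append]
  simp [last, order, levelOrder]

lemma idxOf_parentOf_mono :
    (order q).Pairwise fun u v =>
      (order q).idxOf (parentOf q u) ≤ (order q).idxOf (parentOf q v) := by
  have zero : (order q).idxOf 0 = 0 := by
    rw [order_eq_cons]
    simp
  have incr : (order q).Pairwise fun u v => (order q).idxOf u ≤ (order q).idxOf v := by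
    rw [List.pairwise_iff_getElem]
    intro i j hi hj hij
    rw [nodup_order.idxOf_getElem, nodup_order.idxOf_getElem]
    exact hij.le
  conv => arg 2; rw [order_eq_cons]
  rw [List.pairwise_cons]
  refine ⟨fun v _ => by simp [zero], List.pairwise_flatMap.2 ⟨fun v _ => ?_, ?_⟩⟩
  · refine List.pairwise_of_forall_mem_list fun a ha b hb => ?_
    rw [parentOf_of_mem_childrenOf ha, parentOf_of_mem_childrenOf hb]
  · refine incr.imp fun {a b} hab u hu v hv => ?_
    rwa [parentOf_of_mem_childrenOf hu, parentOf_of_mem_childrenOf hv]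

lemma louds_length (hq : WellFounded fun c Z : Fin n => q Z = c.succ) :
    (louds (childrenOf q) 0 (n + 1)).length = 2 * n + 3 := by
  have len : (order q).length = n + 1 := by simpa using (order_perm hq).length_eq
  have len' : ((order q).flatMap (childrenOf q)).length = n := by
    have := congrArg List.length (order_eq_cons (q := q))
    simp only [List.length_cons] at this
    omega
  have key : ∀ l : List (Fin (n + 1)),
      (l.flatMap fun v => List.replicate (childrenOf q v).length true ++ [false]).length =
        l.length + (l.flatMap (childrenOf q)).length := by
    intro l
    induction l with
    | nil => rfl
    | cons v l ih =>
      simp only [List.flatMap_cons, List.length_append, List.length_replicate, List.length_cons,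
        List.length_nil, ih]
      omega
  rw [louds, List.length_append, show levelOrder (childrenOf q) 0 (n + 1) = order q from rfl, key,
    len, len']
  simp only [List.length_cons, List.length_nil]
  omega

end Tree

/-! ### The two trees of a grammar -/

namespace Grammar

variable {n : ℕ} (G : Grammar n)

lemma leftChildren_eq : G.leftChildren = childrenOf G.leftParent := rfl

lemma rightChildren_eq : G.rightChildren = childrenOf G.rightParent := rfl

lemma leftParent_of_rule {Z : Fin n} {p} (h : G.rule Z = some p) :
    G.leftParent Z = p.1.succ := by
  simp [leftParent, h, node]

lemma rightParent_of_rule {Z : Fin n} {p} (h : G.rule Z = some p) :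
    G.rightParent Z = p.2.succ := by
  simp [rightParent, h, node]

lemma rule_of_leftParent {Z X : Fin n} (h : G.leftParent Z = X.succ) :
    ∃ Y, G.rule Z = some (X, Y) := by
  cases hr : G.rule Z with
  | none => simp [leftParent, hr, (Fin.succ_ne_zero X).symm] at h
  | some p =>
    rw [G.leftParent_of_rule hr, Fin.succ_inj] at h
    exact ⟨p.2, by rw [← h]⟩

lemma rule_of_rightParent {Z Y : Fin n} (h : G.rightParent Z = Y.succ) :
    ∃ X, G.rule Z = some (X, Y) := by
  cases hr : G.rule Z with
  | none => simp [rightParent, hr, (Fin.succ_ne_zero Y).symm] at h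
  | some p =>
    rw [G.rightParent_of_rule hr, Fin.succ_inj] at h
    exact ⟨p.1, by rw [← h]⟩

lemma wf_left : WellFounded fun c Z : Fin n => G.leftParent Z = c.succ :=
  Subrelation.wf (fun {c Z} h => by
    obtain ⟨Y, hY⟩ := G.rule_of_leftParent h
    exact ⟨_, hY, Or.inl rfl⟩) G.acyclic

lemma wf_right : WellFounded fun c Z : Fin n => G.rightParent Z = c.succ :=
  Subrelation.wf (fun {c Z} h => by
    obtain ⟨X, hX⟩ := G.rule_of_rightParent h
    exact ⟨_, hX, Or.inr rfl⟩) G.acyclic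

variable {G}

lemma SortedNames.pairwise_level (hG : G.SortedNames) (h : ℕ) :
    (levelList (childrenOf G.leftParent) 0 h).Pairwise (· < ·) := by
  induction h with
  | zero => simp [levelList]
  | succ h ih =>
    rw [levelList, List.pairwise_flatMap]
    refine ⟨fun v _ => pairwise_childrenOf v, ih.imp_of_mem ?_⟩
    intro a b ha hb hab u hu v hv
    obtain ⟨Z, hZ, rfl⟩ := mem_childrenOf.1 hu
    obtain ⟨Z', hZ', rfl⟩ := mem_childrenOf.1 hv
    rcases Fin.eq_zero_or_eq_succ a with rfl | ⟨X, rfl⟩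
    · -- the root is the only node of its level
      obtain rfl := zero_mem_level.1 ha
      obtain rfl : b = 0 := by simpa [levelList] using hb
      exact absurd hab (lt_irrefl _)
    rcases Fin.eq_zero_or_eq_succ b with rfl | ⟨X', rfl⟩
    · exact absurd hab (by simp)
    obtain ⟨Y, hY⟩ := G.rule_of_leftParent hZ
    obtain ⟨Y', hY'⟩ := G.rule_of_leftParent hZ'
    have lvl : ∀ {W : Fin n} {c : Fin (n + 1)}, G.leftParent W = c →
        c ∈ levelList (childrenOf G.leftParent) 0 h → G.InLevel (h + 1) W := fun hW hc =>
      mem_level_succ.2 ⟨_, rfl, hW ▸ hc⟩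
    exact Fin.succ_lt_succ_iff.2 (hG.2 _ _ _ _ _ _ _ (lvl hZ ha) (lvl hZ' hb) hY hY'
      (Or.inl (Fin.succ_lt_succ_iff.1 hab)))

/-- With the names given by the preprocessing, the level-order number of a node of the left tree
is its name. -/
lemma SortedNames.order_eq (hG : G.SortedNames) : order G.leftParent = List.finRange (n + 1) := by
  refine (order_perm G.wf_left).eq_of_pairwise (le := (· ≤ ·))
    (fun a b _ _ h h' => le_antisymm h h') ?_
    ((List.pairwise_lt_finRange _).imp le_of_lt)
  rw [order, levelOrder, List.pairwise_flatMap]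
  refine ⟨fun h _ => (hG.pairwise_level h).imp le_of_lt, List.pairwise_lt_range.imp ?_⟩
  intro h h' hh u hu v hv
  rcases Fin.eq_zero_or_eq_succ u with rfl | ⟨Z, rfl⟩
  · exact Fin.zero_le v
  rcases Fin.eq_zero_or_eq_succ v with rfl | ⟨Z', rfl⟩
  · obtain rfl := zero_mem_level.1 hv
    omega
  exact (Fin.succ_lt_succ_iff.2 (hG.1 _ _ _ _ hu hv hh)).le

/-- In the left tree, parents are monotone in the names. -/
lemma SortedNames.left_mono (hG : G.SortedNames) : Monotone (parentOf G.leftParent) := by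
  have key := idxOf_parentOf_mono (q := G.leftParent)
  rw [hG.order_eq, List.pairwise_iff_getElem] at key
  refine monotone_iff_forall_lt.2 fun a b hab => ?_
  have := key a b (by simp [a.is_le]) (by simp [b.is_le]) hab
  simpa using this

/-- Among the symbols with the same left child, the names are sorted by the right child. -/
lemma SortedNames.right_mono (hG : G.SortedNames) {u v : Fin (n + 1)} (huv : u ≤ v)
    (h : parentOf G.leftParent u = parentOf G.leftParent v) :
    parentOf G.rightParent u ≤ parentOf G.rightParent v := by
  rcases Fin.eq_zero_or_eq_succ u with rfl | ⟨Z, rfl⟩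
  · exact Fin.zero_le _
  rcases Fin.eq_zero_or_eq_succ v with rfl | ⟨Z', rfl⟩
  · exact absurd huv (by simp)
  simp only [parentOf_succ] at h ⊢
  cases hr : G.rule Z with
  | none => simp [rightParent, hr]
  | some p =>
    have hp := G.leftParent_of_rule hr
    obtain ⟨Y', hY'⟩ := G.rule_of_leftParent (h ▸ hp)
    rw [G.rightParent_of_rule hr, G.rightParent_of_rule hY', Fin.succ_le_succ_iff]
    by_contra! hlt
    obtain ⟨l, hl⟩ := exists_level G.wf_left (G.leftParent Z)
    have h1 : G.InLevel (l + 1) Z := mem_level_succ.2 ⟨_, rfl, hl⟩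
    have h2 : G.InLevel (l + 1) Z' := mem_level_succ.2 ⟨_, rfl, h ▸ hl⟩
    have := hG.2 _ _ _ _ _ _ _ h2 h1 hY' hr (Or.inr ⟨rfl, hlt⟩)
    exact absurd (Fin.succ_le_succ_iff.1 huv) (not_le.2 this)

variable (G)

lemma parents_iff {u : Fin (n + 1)} {X Y : Fin n} :
    parentOf G.leftParent u = X.succ ∧ parentOf G.rightParent u = Y.succ ↔
      ∃ Z : Fin n, u = Z.succ ∧ G.rule Z = some (X, Y) := by
  constructor
  · rintro ⟨h1, h2⟩
    rcases Fin.eq_zero_or_eq_succ u with rfl | ⟨Z, rfl⟩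
    · exact absurd h1 (Fin.succ_ne_zero X).symm
    obtain ⟨Y', hY'⟩ := G.rule_of_leftParent h1
    have := h2
    rw [parentOf_succ, G.rightParent_of_rule hY', Fin.succ_inj] at this
    exact ⟨Z, rfl, by rw [hY', ← this]⟩
  · rintro ⟨Z, rfl, hZ⟩
    exact ⟨G.leftParent_of_rule hZ, G.rightParent_of_rule hZ⟩

/-- The answer to a query is the only node with the given parents in the two trees. -/
lemma parents_iff_answer {u : Fin (n + 1)} {X Y : Fin n} :
    parentOf G.leftParent u = X.succ ∧ parentOf G.rightParent u = Y.succ ↔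
      (u : ℕ) = answer (G.reverseDict X Y) ∧ u ≠ 0 := by
  rw [parents_iff]
  cases hd : G.reverseDict X Y with
  | none =>
    simp only [reverseDict, List.find?_eq_none, List.mem_finRange, decide_eq_true_eq] at hd
    simp only [answer]
    constructor
    · rintro ⟨Z, -, hZ⟩
      exact absurd hZ (hd Z trivial)
    · rintro ⟨h, h'⟩
      exact absurd (Fin.ext h) h'
  | some Z =>
    have hZ : G.rule Z = some (X, Y) := by
      have := List.find?_some hd
      simpa using this
    simp only [answer, node]
    constructor
    · rintro ⟨Z', rfl, hZ'⟩
      exact ⟨by rw [G.rule_inj _ _ _ hZ hZ'], Fin.succ_ne_zero _⟩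
    · rintro ⟨h, -⟩
      exact ⟨Z, Fin.ext h, hZ⟩

lemma maxDegree_le : G.maxDegree ≤ n := by
  refine Finset.sup_le fun v _ => ?_
  rw [leftChildren, List.length_map]
  exact (List.length_filter_le _ _).trans (by simp)

lemma card_children_le (v : Fin (n + 1)) :
    (Finset.univ.filter fun Z : Fin n => G.leftParent Z = v).card ≤ G.maxDegree := by
  have h : (G.leftChildren v).length ≤ G.maxDegree :=
    Finset.le_sup (f := fun v => (G.leftChildren v).length) (Finset.mem_univ v)
  refine le_trans (le_of_eq ?_) h
  rw [leftChildren, List.length_map, ← List.toFinset_card_of_nodup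
    ((List.nodup_finRange n).filter _)]
  congr 1
  ext Z
  simp

lemma one_le_maxDegree (Z : Fin n) : 1 ≤ G.maxDegree :=
  le_trans (Finset.card_pos.2 ⟨Z, by simp⟩) (G.card_children_le (G.leftParent Z))

end Grammar

/-! ### Running programs of the word RAM -/

section Runs

variable {w : ℕ} {mem : List Bool} {p q r : Prog} {s : ℕ → ℕ} {T T' : ℕ}
  {Q Q' : (ℕ → ℕ) → Prop}

/-- Started with the registers `s`, the program `p` halts after at most `T` steps, with registers
that satisfy `Q`. -/
def Runs (w : ℕ) (mem : List Bool) (p : Prog) (s : ℕ → ℕ) (T : ℕ) (Q : (ℕ → ℕ) → Prop) : Prop :=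
  ∃ t s', Exec w mem p s t s' ∧ t ≤ T ∧ Q s'

lemma Runs.mono (h : Runs w mem p s T Q) (hT : T ≤ T') (hQ : ∀ s, Q s → Q' s) :
    Runs w mem p s T' Q' := by
  obtain ⟨t, s', he, ht, hs⟩ := h
  exact ⟨t, s', he, ht.trans hT, hQ _ hs⟩

lemma runs_skip (h : Q s) : Runs w mem .skip s (T + 1) Q :=
  ⟨1, s, .skip s, by omega, h⟩

lemma runs_const {d c : ℕ} (h : Q (Function.update s d (c % 2 ^ w))) :
    Runs w mem (.const d c) s (T + 1) Q :=
  ⟨1, _, .const s d c, by omega, h⟩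

lemma runs_op {o : Op} {d x y : ℕ} (h : Q (Function.update s d (o.eval (s x) (s y) % 2 ^ w))) :
    Runs w mem (.op o d x y) s (T + 1) Q :=
  ⟨1, _, .op s o d x y, by omega, h⟩

lemma runs_load {d x : ℕ} (h : Q (Function.update s d (readWord w mem (s x)))) :
    Runs w mem (.load d x) s (T + 1) Q :=
  ⟨1, _, .load s d x, by omega, h⟩

lemma Runs.seq (h : Runs w mem p s T fun s' => Runs w mem q s' T' Q) :
    Runs w mem (.seq p q) s (T' + T) Q := by
  obtain ⟨t, s', he, ht, t', s'', he', ht', h⟩ := h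
  exact ⟨t + t', s'', .seq he he', by omega, h⟩

lemma runs_assoc (h : Runs w mem (.seq p (.seq q r)) s T Q) :
    Runs w mem (.seq (.seq p q) r) s T Q := by
  obtain ⟨t, s', he, ht, h⟩ := h
  cases he with
  | seq h1 h2 =>
    cases h2 with
    | seq h3 h4 => exact ⟨_, s', .seq (.seq h1 h3) h4, by omega, h⟩

lemma runs_const_seq {d c : ℕ} (h : Runs w mem q (Function.update s d (c % 2 ^ w)) T Q) :
    Runs w mem (.seq (.const d c) q) s (T + 1) Q :=
  Runs.seq (T := 1) (runs_const h)

lemma runs_op_seq {o : Op} {d x y : ℕ}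
    (h : Runs w mem q (Function.update s d (o.eval (s x) (s y) % 2 ^ w)) T Q) :
    Runs w mem (.seq (.op o d x y) q) s (T + 1) Q :=
  Runs.seq (T := 1) (runs_op h)

lemma runs_load_seq {d x : ℕ}
    (h : Runs w mem q (Function.update s d (readWord w mem (s x))) T Q) :
    Runs w mem (.seq (.load d x) q) s (T + 1) Q :=
  Runs.seq (T := 1) (runs_load h)

lemma runs_ite {x y : ℕ} (h : s x < s y → Runs w mem p s T Q)
    (h' : ¬ s x < s y → Runs w mem q s T Q) : Runs w mem (.ite x y p q) s (T + 1) Q := by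
  by_cases hxy : s x < s y
  · obtain ⟨t, s', he, ht, hs⟩ := h hxy
    exact ⟨t + 1, s', .ite_true hxy he, by omega, hs⟩
  · obtain ⟨t, s', he, ht, hs⟩ := h' hxy
    exact ⟨t + 1, s', .ite_false hxy he, by omega, hs⟩

/-- A loop with the invariant `I m`, where `m` bounds the number of the remaining iterations. -/
lemma runs_loop {x y : ℕ} (I : ℕ → (ℕ → ℕ) → Prop) (exit : ∀ m s, I m s → ¬ s x < s y → Q s)
    (pos : ∀ s, I 0 s → ¬ s x < s y)
    (body : ∀ m s, I (m + 1) s → s x < s y → Runs w mem p s T (I m)) (m : ℕ) (h : I m s) :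
    Runs w mem (.loop x y p) s (m * (T + 1) + 1) Q := by
  induction m generalizing s with
  | zero => exact ⟨1, s, .loop_false (pos s h), by omega, exit 0 s h (pos s h)⟩
  | succ m ih =>
    by_cases hxy : s x < s y
    · obtain ⟨t, s', he, ht, hs⟩ := body m s h hxy
      obtain ⟨t', s'', he', ht', hs'⟩ := ih hs
      refine ⟨t + 1 + t', s'', .loop_true hxy he he', ?_, hs'⟩
      rw [Nat.succ_mul]
      omega
    · exact ⟨1, s, .loop_false hxy, by omega, exit _ s h hxy⟩

end Runs

/-! ### The query program -/

/-- Register `d` gets the field whose number is in register `idx`, of the array that starts at the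
bit address in register `base` and whose fields have the width in register `width`; register `mask`
holds two to the power of the width. -/
def fieldProg (d idx width mask base : ℕ) : Prog :=
  .seq (.op .mul 30 idx width) <| .seq (.op .add 30 30 base) <| .seq (.load d 30) <|
    .op .mod d d mask

/-- Register `d` gets the word number `off + 3 * j`, where `j` is in register `idx` and the word
length in register `2`. -/
def wordProg (d idx off : ℕ) : Prog :=
  .seq (.const 30 3) <| .seq (.op .mul 30 30 idx) <| .seq (.const 31 off) <|
    .seq (.op .add 30 30 31) <| .seq (.op .mul 30 30 2) <| .load d 30

/-- Register `d` gets the word number `i`. -/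
def headerProg (d i : ℕ) : Prog :=
  .seq (.const 30 i) <| .seq (.op .mul 30 30 2) <| .load d 30

/-- Loads the header of the index into the registers `2` to `11`. -/
def loadHeader : Prog :=
  .seq (.load 2 2) <| .seq (headerProg 3 1) <| .seq (headerProg 4 2) <| .seq (headerProg 5 3) <|
    .seq (headerProg 6 4) <| .seq (headerProg 7 5) <| .seq (headerProg 8 6) <|
    .seq (headerProg 9 7) <| .seq (headerProg 10 8) <| .const 11 1

/-- Computes what depends on the query only: block number and offset of `X`, the range of the
children of the block of `X` in the left tree, the key of `(X, Y)`, the number of `Y` in the right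
tree with its block number and offset, and the range of the children of its block in the right
tree. -/
def prepare : Prog :=
  .seq (.op .div 12 0 3) <| .seq (.op .mod 13 0 3) <| .seq (wordProg 14 12 9) <|
    .seq (wordProg 15 12 12) <| .seq (.op .mul 30 0 10) <| .seq (.op .add 16 30 1) <|
    .seq (fieldProg 17 1 4 5 9) <| .seq (.op .div 18 17 3) <| .seq (.op .mod 19 17 3) <|
    .seq (wordProg 20 18 10) <| .seq (wordProg 21 18 13) <| .const 22 0

/-- The initial range of the binary search: register `23` is one more than the number of the last
sample before the range of children, register `24` bounds the numbers of the samples in the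
range. -/
def initSearch : Prog :=
  .seq (.op .div 23 14 3) <| .seq (.op .add 23 23 11) <| .seq (.op .sub 24 15 11) <|
    .seq (.op .div 24 24 3) <| .op .add 24 24 11

/-- A step of the binary search. -/
def searchStep : Prog :=
  .seq (.op .add 25 23 24) <| .seq (.const 30 2) <| .seq (.op .div 25 25 30) <|
    .seq (wordProg 26 25 11) <| .ite 16 26 (.op .add 24 25 22) (.op .add 23 25 11)

/-- The range of the candidates after the binary search. -/
def initScan : Prog :=
  .seq (.op .sub 27 23 11) <| .seq (.op .mul 27 27 3) <| .seq (.op .add 28 27 3) <| .const 29 0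

/-- Register `29` gets the candidate in register `27` if its parents are the ones of the query. -/
def testProg : Prog :=
  .ite 27 14 .skip <| .ite 27 15 (.seq (fieldProg 32 27 6 7 8) <|
    .ite 32 13 .skip <| .ite 13 32 .skip <| .seq (fieldProg 33 27 4 5 9) <|
    .ite 33 20 .skip <| .ite 33 21 (.seq (.op .add 34 33 10) <| .seq (fieldProg 35 34 6 7 8) <|
      .ite 35 19 .skip <| .ite 19 35 .skip <| .op .add 29 27 22) .skip) .skip

/-- The query program. -/
def queryProg : Prog :=
  .seq loadHeader <| .seq prepare <| .seq initSearch <| .seq (.loop 23 24 searchStep) <|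
    .seq initScan <| .seq (.loop 27 28 (.seq testProg (.op .add 27 27 11))) <| .op .add 0 29 22

section Macros

variable {w : ℕ} {mem : List Bool} {q : Prog} {s : ℕ → ℕ} {T : ℕ} {Q : (ℕ → ℕ) → Prop}

lemma runs_field {d idx width mask base a : ℕ} (ha : base ≠ 30) (hm : mask ≠ 30) (hmd : mask ≠ d)
    (hA : s base + s width * s idx = a) (haw : a < 2 ^ w) (hmw : s mask < 2 ^ w)
    (hm0 : 0 < s mask)
    (h : ∀ s', s' d = readWord w mem a % s mask → (∀ r, r ≠ d → r ≠ 30 → s' r = s r) →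
      Runs w mem q s' T Q) :
    Runs w mem (.seq (fieldProg d idx width mask base) q) s (T + 4) Q := by
  unfold fieldProg
  refine runs_assoc (runs_op_seq (runs_assoc (runs_op_seq (runs_assoc (runs_load_seq
    (runs_op_seq (h _ ?_ ?_)))))))
  · have e : s idx * s width = s width * s idx := Nat.mul_comm _ _
    have l1 : s width * s idx < 2 ^ w := by omega
    simp only [Function.update_self, Op.eval, Function.update_of_ne ha, Function.update_of_ne hmd,
      Function.update_of_ne hm, e, Nat.mod_eq_of_lt l1]
    rw [show s width * s idx + s base = a by omega, Nat.mod_eq_of_lt haw]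
    exact Nat.mod_eq_of_lt ((Nat.mod_lt _ hm0).trans hmw)
  · intro r h1 h2
    simp [Function.update_of_ne, h1, h2]

lemma runs_word {d idx off a : ℕ} (h30 : idx ≠ 30)
    (h2 : s 2 = w) (hA : off + 3 * s idx = a) (haw : w * a < 2 ^ w) (hw : 2 ≤ w)
    (h : ∀ s', s' d = readWord w mem (w * a) → (∀ r, r ≠ d → r ≠ 30 → r ≠ 31 → s' r = s r) →
      Runs w mem q s' T Q) :
    Runs w mem (.seq (wordProg d idx off) q) s (T + 6) Q := by
  unfold wordProg
  refine runs_assoc (runs_const_seq (runs_assoc (runs_op_seq (runs_assoc (runs_const_seq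
    (runs_assoc (runs_op_seq (runs_assoc (runs_op_seq (runs_load_seq (h _ ?_ ?_)))))))))))
  · have l0 : a < 2 ^ w := lt_of_le_of_lt (Nat.le_mul_of_pos_left a (by omega)) haw
    have l3 : 3 < 2 ^ w := lt_of_lt_of_le (by norm_num) (Nat.pow_le_pow_right (by norm_num) hw)
    have l1 : 3 * s idx < 2 ^ w := by omega
    have l2 : off < 2 ^ w := by omega
    simp [Function.update_of_ne, h30, Op.eval, h2, Nat.mod_eq_of_lt l3, Nat.mod_eq_of_lt l1,
      Nat.mod_eq_of_lt l2, Nat.add_comm _ off, hA, Nat.mod_eq_of_lt l0, Nat.mul_comm _ w,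
      Nat.mod_eq_of_lt haw]
  · intro r h1 h2 h3
    simp [Function.update_of_ne, h1, h2, h3]

/-- The registers below `m` have the values given by `v`. -/
def Agree (v : ℕ → ℕ) (m : ℕ) (s : ℕ → ℕ) : Prop := ∀ r < m, s r = v r

variable {v : ℕ → ℕ} {m : ℕ}

lemma Agree.frame (h : Agree v m s) {s' : ℕ → ℕ} (h' : ∀ r < m, s' r = s r) : Agree v m s' :=
  fun r hr => (h' r hr).trans (h r hr)

lemma Agree.update (h : Agree v m s) {d x : ℕ} (hd : m ≤ d) : Agree v m (Function.update s d x) :=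
  h.frame fun r hr => Function.update_of_ne (by omega) _ _

lemma Agree.extend (h : Agree v m s) {s' : ℕ → ℕ} (h' : ∀ r < m, s' r = s r) (hm : s' m = v m) :
    Agree v (m + 1) s' := by
  intro r hr
  rcases (Nat.lt_succ_iff.1 hr).lt_or_eq with h1 | rfl
  · exact (h.frame h') r h1
  · exact hm

lemma Agree.update_self (h : Agree v m s) {x : ℕ} (hx : x = v m) :
    Agree v (m + 1) (Function.update s m x) :=
  h.extend (fun r hr => Function.update_of_ne (by omega) _ _) (by simp [hx])

lemma Agree.op_seq (h : Agree v m s) {o : Op} {x y : ℕ} (hx : x < m) (hy : y < m)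
    (hv : o.eval (v x) (v y) = v m) (hw : v m < 2 ^ w)
    (hq : ∀ s, Agree v (m + 1) s → Runs w mem q s T Q) :
    Runs w mem (.seq (.op o m x y) q) s (T + 1) Q :=
  runs_op_seq (hq _ (h.update_self (by rw [h x hx, h y hy, hv, Nat.mod_eq_of_lt hw])))

lemma Agree.word_seq (h : Agree v m s) {idx off a : ℕ} (hm : m ≤ 30) (hidx : idx < m) (h2m : 2 < m)
    (h2 : v 2 = w) (hA : off + 3 * v idx = a) (haw : w * a < 2 ^ w) (hw : 2 ≤ w)
    (hv : readWord w mem (w * a) = v m) (hq : ∀ s, Agree v (m + 1) s → Runs w mem q s T Q) :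
    Runs w mem (.seq (wordProg m idx off) q) s (T + 6) Q :=
  runs_word (by omega) (by rw [h 2 h2m, h2]) (by rw [h idx hidx, hA]) haw hw fun s' h1 h3 =>
    hq _ (h.extend (fun r hr => h3 r (by omega) (by omega) (by omega)) (h1.trans hv))

lemma Agree.header_seq (h : Agree v m s) {i : ℕ} (hm : m ≤ 30) (h2m : 2 < m) (h2 : v 2 = w)
    (hiw : w * i < 2 ^ w) (hw : 1 ≤ w) (hv : readWord w mem (w * i) = v m)
    (hq : ∀ s, Agree v (m + 1) s → Runs w mem q s T Q) :
    Runs w mem (.seq (headerProg m i) q) s (T + 3) Q := by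
  unfold headerProg
  have l0 : i < 2 ^ w := lt_of_le_of_lt (Nat.le_mul_of_pos_left i (by omega)) hiw
  refine runs_assoc (runs_const_seq (runs_assoc (runs_op_seq (runs_load_seq
    (hq _ (h.extend (fun r hr => ?_) ?_))))))
  · rw [Function.update_of_ne (by omega), Function.update_of_ne (by omega),
      Function.update_of_ne (by omega)]
  · simp [Op.eval, Nat.mod_eq_of_lt l0, h 2 h2m, h2, Nat.mul_comm i w, Nat.mod_eq_of_lt hiw, hv]

end Macros

/-! ### Correctness of the query program -/

/-- The number of nodes `z ≤ n` whose parent `f z` is less than `q`. For a monotone parent function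
these are the nodes before the first child of `q`. -/
def start (n : ℕ) (f : ℕ → ℕ) (q : ℕ) : ℕ := ((Finset.range (n + 1)).filter fun z => f z < q).card

lemma start_le (n : ℕ) (f : ℕ → ℕ) (q : ℕ) : start n f q ≤ n + 1 :=
  (Finset.card_filter_le _ _).trans (by simp)

lemma start_le_iff {n : ℕ} {f : ℕ → ℕ} (hf : ∀ y z, y ≤ z → z ≤ n → f y ≤ f z) {q z : ℕ}
    (hz : z ≤ n) : start n f q ≤ z ↔ q ≤ f z := by
  constructor
  · intro h
    by_contra! hlt
    have : Finset.range (z + 1) ⊆ (Finset.range (n + 1)).filter fun z => f z < q := by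
      intro y hy
      simp only [Finset.mem_range, Finset.mem_filter] at hy ⊢
      exact ⟨by omega, (hf y z (by omega) hz).trans_lt hlt⟩
    have := Finset.card_le_card this
    rw [Finset.card_range] at this
    unfold start at h
    omega
  · intro h
    have : ((Finset.range (n + 1)).filter fun z => f z < q) ⊆ Finset.range z := by
      intro y hy
      simp only [Finset.mem_range, Finset.mem_filter] at hy ⊢
      by_contra! hle
      have := hf z y hle (by omega)
      omega
    simpa [start] using Finset.card_le_card this

/-- The nodes with parent in a block of `s` nodes: at most `k` for each node of the block, and the
root. -/
lemma start_add_le {n k : ℕ} {f : ℕ → ℕ}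
    (hk : ∀ q, ((Finset.Icc 1 n).filter fun z => f z = q).card ≤ k) (q s : ℕ) :
    start n f (q + s) ≤ start n f q + (s * k + 1) := by
  have sub : ((Finset.range (n + 1)).filter fun z => f z < q + s) ⊆
      ((Finset.range (n + 1)).filter fun z => f z < q) ∪
        (insert 0 ((Finset.Icc 1 n).filter fun z => f z ∈ Finset.Ico q (q + s))) := by
    intro z hz
    simp only [Finset.mem_filter, Finset.mem_range, Finset.mem_union, Finset.mem_insert,
      Finset.mem_Icc, Finset.mem_Ico] at hz ⊢
    omega
  have cnt : ((Finset.Icc 1 n).filter fun z => f z ∈ Finset.Ico q (q + s)).card ≤ k * s := by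
    have := Finset.card_le_mul_card_image_of_maps_to
      (s := (Finset.Icc 1 n).filter fun z => f z ∈ Finset.Ico q (q + s)) (t := Finset.Ico q (q + s))
      (f := f) (fun z hz => (Finset.mem_filter.1 hz).2) k (fun a _ => by
        refine le_trans (Finset.card_le_card fun z hz => ?_) (hk a)
        simp only [Finset.mem_filter] at hz ⊢
        exact ⟨hz.1.1, hz.2⟩)
    simpa using this
  have h := Finset.card_le_card sub
  have h1 := Finset.card_union_le ((Finset.range (n + 1)).filter fun z => f z < q)
    (insert 0 ((Finset.Icc 1 n).filter fun z => f z ∈ Finset.Ico q (q + s)))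
  have h2 := Finset.card_insert_le 0 ((Finset.Icc 1 n).filter fun z => f z ∈ Finset.Ico q (q + s))
  rw [Nat.mul_comm] at cnt
  unfold start
  omega

/-- The memory holds the index for the parent functions `pL` and `pR` of the two trees (on
level-order numbers), the permutation `P` between their numberings, and the function `yv` that
sends a node to its parent in the right tree (in the numbering of the left tree).

The index consists of words (the header and, for every `s`-th node, the starts of its children in
both trees and its key), and of the fields of width `c`, at address `bM`, that hold the parent
numbers modulo `s`. The fields of width `b` at address `bP` hold `P`. -/
structure IsIndex (w : ℕ) (mem : List Bool) (n s b c bM bP : ℕ) (pL pR P yv : ℕ → ℕ) : Prop where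
  header0 : readWord w mem 0 = w
  header1 : readWord w mem (w * 1) = s
  header2 : readWord w mem (w * 2) = b
  header3 : readWord w mem (w * 3) = 2 ^ b
  header4 : readWord w mem (w * 4) = c
  header5 : readWord w mem (w * 5) = 2 ^ c
  header6 : readWord w mem (w * 6) = bM
  header7 : readWord w mem (w * 7) = bP
  header8 : readWord w mem (w * 8) = n + 1
  start_left : ∀ j, j ≤ n / s + 1 → readWord w mem (w * (9 + 3 * j)) = start n pL (s * j)
  start_right : ∀ j, j ≤ n / s + 1 → readWord w mem (w * (10 + 3 * j)) = start n pR (s * j)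
  key : ∀ j, s * j ≤ n → readWord w mem (w * (11 + 3 * j)) = pL (s * j) * (n + 1) + yv (s * j)
  mod_left : ∀ z ≤ n, readWord w mem (bM + c * z) % 2 ^ c = pL z % s
  mod_right : ∀ z ≤ n, readWord w mem (bM + c * (n + 1 + z)) % 2 ^ c = pR z % s
  perm : ∀ z ≤ n, readWord w mem (bP + b * z) % 2 ^ b = P z
  s_pos : 1 ≤ s
  s_le : s ≤ n + 1
  word : 2 ≤ w
  key_lt : (n + 1) * (n + 1) < 2 ^ w
  words_lt : w * (18 + 3 * n) < 2 ^ w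
  mods_lt : bM + c * (2 * n + 2) < 2 ^ w
  perm_lt : bP + b * (n + 1) < 2 ^ w
  c_lt : 2 ^ c < 2 ^ w
  b_lt : 2 ^ b < 2 ^ w

/-- The properties of the parent functions that the queries depend on. -/
structure IsForestPair (n k : ℕ) (pL pR P yv : ℕ → ℕ) : Prop where
  left_mono : ∀ y z, y ≤ z → z ≤ n → pL y ≤ pL z
  right_mono : ∀ y z, y ≤ z → z ≤ n → pR y ≤ pR z
  left_le : ∀ z, pL z ≤ n
  yv_le : ∀ z, yv z ≤ n
  perm_le : ∀ z, P z ≤ n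
  perm_inj : ∀ y z, y ≤ n → z ≤ n → P y = P z → y = z
  right_perm : ∀ z ≤ n, pR (P z) = P (yv z)
  yv_mono : ∀ y z, y ≤ z → z ≤ n → pL y = pL z → yv y ≤ yv z
  degree : ∀ q, ((Finset.Icc 1 n).filter fun z => pL z = q).card ≤ k

section Query

variable {w : ℕ} {mem : List Bool} {n k s b c bM bP : ℕ} {pL pR P yv : ℕ → ℕ} {X Y ans : ℕ}

/-- Pairs below `n + 1` are ordered lexicographically like their keys. -/
lemma IsForestPair.key_mono (F : IsForestPair n k pL pR P yv) {y z : ℕ} (h : y ≤ z) (hz : z ≤ n) :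
    pL y * (n + 1) + yv y ≤ pL z * (n + 1) + yv z := by
  rcases (F.left_mono y z h hz).lt_or_eq with hlt | heq
  · have := Nat.mul_le_mul_right (n + 1) (Nat.succ_le_of_lt hlt)
    rw [Nat.succ_mul] at this
    have := F.yv_le y
    omega
  · rw [heq]
    have := F.yv_mono y z h hz heq
    omega

lemma key_inj {x y x' y' N : ℕ} (hy : y < N) (hy' : y' < N) (h : x * N + y = x' * N + y') :
    x = x' ∧ y = y' := by
  have hN : 0 < N := by omega
  have h1 : (x * N + y) / N = x := by
    rw [Nat.mul_comm, Nat.mul_add_div hN, Nat.div_eq_of_lt hy, Nat.add_zero]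
  have h2 : (x' * N + y') / N = x' := by
    rw [Nat.mul_comm, Nat.mul_add_div hN, Nat.div_eq_of_lt hy', Nat.add_zero]
  obtain rfl : x = x' := by rw [← h1, ← h2, h]
  exact ⟨rfl, by omega⟩

/-- A number is determined by its block of length `s` and its residue modulo `s`. -/
lemma eq_of_block {x y s : ℕ} (hs : 1 ≤ s) (h1 : s * (x / s) ≤ y) (h2 : y < s * (x / s + 1))
    (h3 : y % s = x % s) : y = x := by
  have hy : y / s = x / s := by
    rw [Nat.div_eq_iff hs]
    rw [Nat.mul_comm] at h1
    rw [Nat.mul_comm, Nat.succ_mul] at h2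
    omega
  rw [← Nat.div_add_mod y s, ← Nat.div_add_mod x s, hy, h3]

/-- The contents of the registers `0` to `22` once they are all set. -/
def registers (w n s b c bM bP : ℕ) (pL pR P : ℕ → ℕ) (X Y : ℕ) (r : ℕ) : ℕ :=
  [X, Y, w, s, b, 2 ^ b, c, 2 ^ c, bM, bP, n + 1, 1, X / s, X % s, start n pL (s * (X / s)),
    start n pL (s * (X / s + 1)), X * (n + 1) + Y, P Y, P Y / s, P Y % s,
    start n pR (s * (P Y / s)), start n pR (s * (P Y / s + 1)), 0].getD r 0

lemma IsIndex.lt_word (I : IsIndex w mem n s b c bM bP pL pR P yv) : 18 + 3 * n < 2 ^ w :=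
  lt_of_le_of_lt (Nat.le_mul_of_pos_left _ (by have := I.word; omega)) I.words_lt

lemma IsIndex.word_lt (I : IsIndex w mem n s b c bM bP pL pR P yv) {i : ℕ} (h : i ≤ 18 + 3 * n) :
    w * i < 2 ^ w :=
  lt_of_le_of_lt (Nat.mul_le_mul_left w h) I.words_lt

local notation "regs" => registers w n s b c bM bP pL pR P X Y

lemma runs_loadHeader (I : IsIndex w mem n s b c bM bP pL pR P yv) {q : Prog} {T : ℕ}
    {Q : (ℕ → ℕ) → Prop} (hq : ∀ s, Agree regs 12 s → Runs w mem q s T Q) :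
    Runs w mem (.seq loadHeader q) (queryState X Y) (T + 26) Q := by
  have hw := I.word
  have h1 := I.lt_word
  unfold loadHeader
  refine runs_assoc (runs_load_seq ?_)
  have h3 : Agree regs 3 (Function.update (queryState X Y) 2
      (readWord w mem (queryState X Y 2))) := by
    intro r hr
    interval_cases r
    · rfl
    · rfl
    · exact I.header0
  refine runs_assoc (h3.header_seq (by decide) (by decide) rfl (I.word_lt (by omega)) (by omega)
    I.header1 fun s4 h4 => ?_)
  refine runs_assoc (h4.header_seq (by decide) (by decide) rfl (I.word_lt (by omega)) (by omega)
    I.header2 fun s5 h5 => ?_)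
  refine runs_assoc (h5.header_seq (by decide) (by decide) rfl (I.word_lt (by omega)) (by omega)
    I.header3 fun s6 h6 => ?_)
  refine runs_assoc (h6.header_seq (by decide) (by decide) rfl (I.word_lt (by omega)) (by omega)
    I.header4 fun s7 h7 => ?_)
  refine runs_assoc (h7.header_seq (by decide) (by decide) rfl (I.word_lt (by omega)) (by omega)
    I.header5 fun s8 h8 => ?_)
  refine runs_assoc (h8.header_seq (by decide) (by decide) rfl (I.word_lt (by omega)) (by omega)
    I.header6 fun s9 h9 => ?_)
  refine runs_assoc (h9.header_seq (by decide) (by decide) rfl (I.word_lt (by omega)) (by omega)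
    I.header7 fun s10 h10 => ?_)
  refine runs_assoc (h10.header_seq (by decide) (by decide) rfl (I.word_lt (by omega)) (by omega)
    I.header8 fun s11 h11 => ?_)
  exact runs_const_seq (hq _ (h11.update_self (Nat.mod_eq_of_lt (by omega))))

lemma runs_prepare (I : IsIndex w mem n s b c bM bP pL pR P yv)
    (F : IsForestPair n k pL pR P yv) (hX : X ≤ n) (hY : Y ≤ n) {q : Prog} {T : ℕ}
    {Q : (ℕ → ℕ) → Prop} {σ : ℕ → ℕ} (hσ : Agree regs 12 σ)
    (hq : ∀ s, Agree regs 23 s → Runs w mem q s T Q) :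
    Runs w mem (.seq prepare q) σ (T + 35) Q := by
  have hw := I.word
  have h1 := I.lt_word
  have hs := I.s_pos
  have hX1 : X / s ≤ n / s := Nat.div_le_div_right hX
  have hP1 : P Y / s ≤ n / s := Nat.div_le_div_right (F.perm_le Y)
  have hns := Nat.div_le_self n s
  have mod_le : ∀ x, x % s < s := fun x => Nat.mod_lt _ hs
  have hm := I.s_le
  have keyb : X * (n + 1) + Y < 2 ^ w := by
    have h := Nat.mul_le_mul_right (n + 1) (show X + 1 ≤ n + 1 by omega)
    have := I.key_lt
    rw [Nat.succ_mul X] at h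
    omega
  unfold prepare
  refine runs_assoc (hσ.op_seq (by decide) (by decide) rfl
    (show X / s < 2 ^ w by omega) fun s13 h13 => ?_)
  refine runs_assoc (h13.op_seq (by decide) (by decide) rfl
    (show X % s < 2 ^ w by have := mod_le X; omega) fun s14 h14 => ?_)
  refine runs_assoc (h14.word_seq (a := 9 + 3 * (X / s)) (by decide) (by decide) (by decide) rfl rfl
    (I.word_lt (by omega)) hw (I.start_left _ (by omega)) fun s15 h15 => ?_)
  refine runs_assoc (h15.word_seq (a := 9 + 3 * (X / s + 1)) (by decide) (by decide) (by decide) rfl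
    (show 12 + 3 * (X / s) = _ by omega)
    (I.word_lt (by omega)) hw (I.start_left _ (by omega)) fun s16 h16 => ?_)
  refine runs_assoc (runs_op_seq (runs_assoc (runs_op_seq ?_)))
  have e30 : (Function.update s16 30 (Op.mul.eval (s16 0) (s16 10) % 2 ^ w)) 30 =
      X * (n + 1) := by
    rw [Function.update_self, h16 0 (by decide), h16 10 (by decide)]
    exact Nat.mod_eq_of_lt (show X * (n + 1) < 2 ^ w by omega)
  have e1 : (Function.update s16 30 (Op.mul.eval (s16 0) (s16 10) % 2 ^ w)) 1 = Y := by
    rw [Function.update_of_ne (by decide), h16 1 (by decide)]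
    rfl
  rw [e30, e1]
  have h17 : Agree regs 17 (Function.update (Function.update s16 30
      (Op.mul.eval (s16 0) (s16 10) % 2 ^ w)) 16 (Op.add.eval (X * (n + 1)) Y % 2 ^ w)) :=
    (h16.update (by decide)).update_self (Nat.mod_eq_of_lt keyb)
  generalize (Function.update (Function.update s16 30
      (Op.mul.eval (s16 0) (s16 10) % 2 ^ w)) 16 (Op.add.eval (X * (n + 1)) Y % 2 ^ w)) = s17 at h17
  have pm := I.perm_lt
  have hbY : b * Y ≤ b * (n + 1) := Nat.mul_le_mul_left _ (by omega)
  refine runs_assoc (runs_field (a := bP + b * Y) (by decide) (by decide) (by decide)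
    (by rw [h17 1 (by decide), h17 4 (by decide), h17 9 (by decide)]; rfl)
    (by omega)
    (by rw [h17 5 (by decide)]; exact I.b_lt)
    (by rw [h17 5 (by decide)]; exact Nat.two_pow_pos b)
    fun s18 hv hf => ?_)
  rw [h17 5 (by decide)] at hv
  have h18 : Agree regs 18 s18 :=
    h17.extend (fun r hr => hf r (by omega) (by omega)) (hv.trans (I.perm Y hY))
  refine runs_assoc (h18.op_seq (by decide) (by decide) rfl
    (show P Y / s < 2 ^ w by omega) fun s19 h19 => ?_)
  refine runs_assoc (h19.op_seq (by decide) (by decide) rfl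
    (show P Y % s < 2 ^ w by have := mod_le (P Y); omega) fun s20 h20 => ?_)
  refine runs_assoc (h20.word_seq (a := 10 + 3 * (P Y / s)) (by decide) (by decide) (by decide) rfl
    rfl (I.word_lt (by omega)) hw (I.start_right _ (by omega)) fun s21 h21 => ?_)
  refine runs_assoc (h21.word_seq (a := 10 + 3 * (P Y / s + 1)) (by decide) (by decide) (by decide)
    rfl (show 13 + 3 * (P Y / s) = _ by omega)
    (I.word_lt (by omega)) hw (I.start_right _ (by omega)) fun s22 h22 => ?_)
  exact runs_const_seq (hq _ (h22.update_self (Nat.zero_mod _)))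

/-- The invariant of the binary search: if the query has an answer, then it lies between the samples
number `u - 1` and `j`, where `u` and `j` are in the registers `23` and `24`. -/
def SearchInv (v : ℕ → ℕ) (n s ans m : ℕ) (σ : ℕ → ℕ) : Prop :=
  Agree v 23 σ ∧ 1 ≤ σ 23 ∧ s * (σ 23 - 1) ≤ n + 1 ∧ s * (σ 24 - 1) ≤ n ∧
    (ans ≠ 0 → s * (σ 23 - 1) ≤ ans ∧ ans < s * σ 24) ∧ σ 24 < σ 23 + 2 ^ m

/-- `ans` is the only node with the parents `X` and `Y`, or `0` if there is none. -/
structure IsAnswer (n : ℕ) (pL yv : ℕ → ℕ) (X Y ans : ℕ) : Prop where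
  le : ans ≤ n
  iff : ∀ z ≤ n, (pL z = X ∧ yv z = Y) ↔ (z = ans ∧ z ≠ 0)

lemma runs_initSearch (I : IsIndex w mem n s b c bM bP pL pR P yv)
    (F : IsForestPair n k pL pR P yv) (A : IsAnswer n pL yv X Y ans) {q : Prog} {T : ℕ}
    {Q : (ℕ → ℕ) → Prop} {σ : ℕ → ℕ} (hσ : Agree regs 23 σ)
    (hq : ∀ σ', SearchInv regs n s ans (Nat.size k) σ' → Runs w mem q σ' T Q) :
    Runs w mem (.seq initSearch q) σ (T + 5) Q := by
  have hs := I.s_pos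
  have h1 := I.lt_word
  set lo := start n pL (s * (X / s)) with hlo
  set hi := start n pL (s * (X / s + 1)) with hhi
  have lo_le : lo ≤ n + 1 := start_le _ _ _
  have hi_le : hi ≤ n + 1 := start_le _ _ _
  have d1 := Nat.div_le_self lo s
  have d2 := Nat.div_le_self (hi - 1) s
  have m1 := Nat.mul_div_le lo s
  have m2 := Nat.mul_div_le (hi - 1) s
  have e3 : σ 3 = s := hσ 3 (by decide)
  have e11 : σ 11 = 1 := hσ 11 (by decide)
  have e14 : σ 14 = lo := hσ 14 (by decide)
  have e15 : σ 15 = hi := hσ 15 (by decide)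
  unfold initSearch
  refine runs_assoc (runs_op_seq (runs_assoc (runs_op_seq (runs_assoc (runs_op_seq (runs_assoc
    (runs_op_seq (runs_op_seq (hq _ ⟨?_, ?_⟩)))))))))
  · exact (((((hσ.update (by decide)).update (by decide)).update (by decide)).update
      (by decide)).update (by decide))
  have l1 : lo / s % 2 ^ w = lo / s := Nat.mod_eq_of_lt (by omega)
  have l2 : (lo / s + 1) % 2 ^ w = lo / s + 1 := Nat.mod_eq_of_lt (by omega)
  have l3 : (hi - 1) % 2 ^ w = hi - 1 := Nat.mod_eq_of_lt (by omega)
  have l4 : (hi - 1) / s % 2 ^ w = (hi - 1) / s := Nat.mod_eq_of_lt (by omega)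
  have l5 : ((hi - 1) / s + 1) % 2 ^ w = (hi - 1) / s + 1 := Nat.mod_eq_of_lt (by omega)
  simp only [Function.update_self, Function.update_of_ne (show (23 : ℕ) ≠ 24 by decide),
    Function.update_of_ne (show (11 : ℕ) ≠ 23 by decide),
    Function.update_of_ne (show (11 : ℕ) ≠ 24 by decide),
    Function.update_of_ne (show (3 : ℕ) ≠ 24 by decide),
    Function.update_of_ne (show (3 : ℕ) ≠ 23 by decide),
    Function.update_of_ne (show (15 : ℕ) ≠ 23 by decide), Op.eval, e3, e11, e14, e15,
    l1, l2, l3, l4, l5, Nat.add_sub_cancel]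
  refine ⟨by omega, by omega, by omega, fun h0 => ?_, ?_⟩
  · have hp := (A.iff ans A.le).2 ⟨rfl, h0⟩
    have g1 : lo ≤ ans := (start_le_iff F.left_mono A.le).2 (by
      rw [hp.1]; exact Nat.mul_div_le X s)
    have g2 : ¬ hi ≤ ans := fun h => by
      have := (start_le_iff F.left_mono A.le).1 h
      rw [hp.1] at this
      have := Nat.lt_mul_div_succ X hs
      omega
    have := Nat.lt_mul_div_succ (hi - 1) hs
    omega
  · -- the range has at most `s * k + 1` nodes, so at most `k + 1` samples
    have g : hi ≤ lo + (s * k + 1) := by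
      rw [hhi, Nat.mul_succ]
      exact start_add_le F.degree _ _
    have : (hi - 1) / s ≤ lo / s + k := by
      calc (hi - 1) / s ≤ (lo + s * k) / s := Nat.div_le_div_right (by omega)
        _ = lo / s + k := Nat.add_mul_div_left _ _ hs
    have := Nat.lt_size_self k
    omega

lemma runs_searchStep (I : IsIndex w mem n s b c bM bP pL pR P yv)
    (F : IsForestPair n k pL pR P yv) (A : IsAnswer n pL yv X Y ans) {m : ℕ} {σ : ℕ → ℕ}
    (hσ : SearchInv regs n s ans (m + 1) σ) (hlt : σ 23 < σ 24) :
    Runs w mem searchStep σ 11 (SearchInv regs n s ans m) := by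
  obtain ⟨hA, hu, hu', hj, hans, hm⟩ := hσ
  have hs := I.s_pos
  have h1 := I.lt_word
  have hu2 : σ 23 - 1 ≤ s * (σ 23 - 1) := Nat.le_mul_of_pos_left _ hs
  have hj2 : σ 24 - 1 ≤ s * (σ 24 - 1) := Nat.le_mul_of_pos_left _ hs
  obtain ⟨u, hu0⟩ : ∃ u, u = σ 23 := ⟨_, rfl⟩
  obtain ⟨j, hj0⟩ : ∃ j, j = σ 24 := ⟨_, rfl⟩
  rw [← hu0] at hlt hu hu' hans hm hu2
  rw [← hj0] at hlt hj hans hm hj2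
  have hmid : s * ((u + j) / 2) ≤ n := (Nat.mul_le_mul_left s (by omega)).trans hj
  have a1 : (u + j) % 2 ^ w = u + j := Nat.mod_eq_of_lt (by omega)
  have a2 : 2 % 2 ^ w = 2 := Nat.mod_eq_of_lt (by omega)
  have a3 : (u + j) / 2 % 2 ^ w = (u + j) / 2 := Nat.mod_eq_of_lt (by omega)
  unfold searchStep
  refine runs_op_seq (runs_const_seq (runs_op_seq ?_))
  simp only [Function.update_self, Function.update_of_ne (show (25 : ℕ) ≠ 30 by decide), Op.eval,
    ← hu0, ← hj0, a1, a2, a3]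
  set σ1 := Function.update (Function.update (Function.update σ 25 (u + j)) 30 2) 25
    ((u + j) / 2) with hσ1
  have hA1 : Agree regs 23 σ1 :=
    ((hA.update (by decide)).update (by decide)).update (by decide)
  have e25 : σ1 25 = (u + j) / 2 := Function.update_self ..
  have e23 : σ1 23 = u := hu0.symm
  have e24 : σ1 24 = j := hj0.symm
  clear_value σ1
  refine runs_word (a := 11 + 3 * ((u + j) / 2)) (by decide) (hA1 2 (by decide)) (by rw [e25])
    (I.word_lt (by omega)) I.word fun σ2 hv hf => ?_
  rw [I.key _ hmid] at hv
  have hA2 : Agree regs 23 σ2 := hA1.frame fun r hr => hf r (by omega) (by omega) (by omega)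
  rw [← hf 25 (by decide) (by decide) (by decide)] at e25
  rw [← hf 23 (by decide) (by decide) (by decide)] at e23
  rw [← hf 24 (by decide) (by decide) (by decide)] at e24
  have e16 : σ2 16 = X * (n + 1) + Y := hA2 16 (by decide)
  have e11 : σ2 11 = 1 := hA2 11 (by decide)
  have e22 : σ2 22 = 0 := hA2 22 (by decide)
  have h2m : 2 ^ (m + 1) = 2 ^ m + 2 ^ m := by rw [Nat.pow_succ]; omega
  refine runs_ite (fun hl => runs_op ⟨hA2.update (by decide), ?_⟩)
    (fun hl => runs_op ⟨hA2.update (by decide), ?_⟩)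
  · simp only [Function.update_self, Function.update_of_ne (show (23 : ℕ) ≠ 24 by decide), Op.eval,
      e25, e22, e23, Nat.add_zero, a3]
    refine ⟨hu, hu', le_trans (Nat.mul_le_mul_left s (by omega)) hj, fun h0 =>
      ⟨(hans h0).1, ?_⟩, by omega⟩
    -- the key of the answer is less than the key of the middle sample
    by_contra! hle
    have := F.key_mono hle A.le
    obtain ⟨hp, hp'⟩ := (A.iff ans A.le).2 ⟨rfl, h0⟩
    rw [hp, hp'] at this
    omega
  · have a4 : ((u + j) / 2 + 1) % 2 ^ w = (u + j) / 2 + 1 := Nat.mod_eq_of_lt (by omega)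
    simp only [Function.update_self, Function.update_of_ne (show (24 : ℕ) ≠ 23 by decide), Op.eval,
      e25, e11, e24, a4, Nat.add_sub_cancel]
    refine ⟨by omega, by omega, hj, fun h0 => ⟨?_, (hans h0).2⟩, by omega⟩
    -- the keys are weakly sorted, and no other node has the key of the answer
    by_contra! hle
    have hk := F.key_mono hle.le hmid
    obtain ⟨hp, hp'⟩ := (A.iff ans A.le).2 ⟨rfl, h0⟩
    have hYn := F.yv_le ans
    rw [hp, hp'] at hk
    have hK : pL (s * ((u + j) / 2)) * (n + 1) + yv (s * ((u + j) / 2)) = X * (n + 1) + Y := by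
      omega
    have hYn' := F.yv_le (s * ((u + j) / 2))
    have := ((A.iff _ hmid).1 (key_inj (by omega) (by omega) hK)).1
    omega

/-- The invariant of the scan of the candidates: either the answer has been found, or it is among
the `m` candidates that are left. -/
def ScanInv (v : ℕ → ℕ) (n ans m : ℕ) (σ : ℕ → ℕ) : Prop :=
  Agree v 23 σ ∧ σ 28 ≤ 2 * n + 2 ∧ σ 28 = σ 27 + m ∧
    (σ 29 = ans ∨ (σ 29 = 0 ∧ σ 27 ≤ ans ∧ ans < σ 28))

lemma runs_initScan (I : IsIndex w mem n s b c bM bP pL pR P yv) {q : Prog} {T m : ℕ}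
    {Q : (ℕ → ℕ) → Prop} {σ : ℕ → ℕ} (hσ : SearchInv regs n s ans m σ) (hle : ¬ σ 23 < σ 24)
    (hq : ∀ σ', ScanInv regs n ans s σ' → Runs w mem q σ' T Q) :
    Runs w mem (.seq initScan q) σ (T + 4) Q := by
  obtain ⟨hA, hu, hu', hj, hans, hm⟩ := hσ
  have hs := I.s_pos
  have hs' := I.s_le
  have h1 := I.lt_word
  have hu2 : σ 23 - 1 ≤ s * (σ 23 - 1) := Nat.le_mul_of_pos_left _ hs
  have e3 : σ 3 = s := hA 3 (by decide)
  have e11 : σ 11 = 1 := hA 11 (by decide)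
  have l1 : (σ 23 - 1) % 2 ^ w = σ 23 - 1 := Nat.mod_eq_of_lt (by omega)
  have l2 : s * (σ 23 - 1) % 2 ^ w = s * (σ 23 - 1) := Nat.mod_eq_of_lt (by omega)
  have l3 : (s * (σ 23 - 1) + s) % 2 ^ w = s * (σ 23 - 1) + s := Nat.mod_eq_of_lt (by omega)
  unfold initScan
  refine runs_assoc (runs_op_seq (runs_assoc (runs_op_seq (runs_assoc (runs_op_seq
    (runs_const_seq (hq _ ⟨?_, ?_⟩)))))))
  · exact ((((hA.update (by decide)).update (by decide)).update (by decide)).update (by decide))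
  simp only [Function.update_self, Function.update_of_ne (show (27 : ℕ) ≠ 28 by decide),
    Function.update_of_ne (show (27 : ℕ) ≠ 29 by decide),
    Function.update_of_ne (show (28 : ℕ) ≠ 29 by decide),
    Function.update_of_ne (show (3 : ℕ) ≠ 27 by decide), Op.eval, e3, e11, Nat.mul_comm _ s,
    l1, l2, l3, Nat.zero_mod]
  refine ⟨by omega, trivial, ?_⟩
  by_cases h0 : ans = 0
  · exact Or.inl h0.symm
  · obtain ⟨g1, g2⟩ := hans h0
    have : s * σ 24 ≤ s * (σ 23 - 1) + s := by
      rw [← Nat.mul_succ]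
      exact Nat.mul_le_mul_left s (by omega)
    exact Or.inr ⟨trivial, g1, by omega⟩

lemma runs_test (I : IsIndex w mem n s b c bM bP pL pR P yv)
    (F : IsForestPair n k pL pR P yv) (hY : Y ≤ n) {σ : ℕ → ℕ} (hA : Agree regs 23 σ) :
    Runs w mem testProg σ 22 fun σ' => Agree regs 23 σ' ∧ σ' 27 = σ 27 ∧ σ' 28 = σ 28 ∧
      ((σ 27 ≤ n ∧ pL (σ 27) = X ∧ yv (σ 27) = Y) → σ' 29 = σ 27) ∧
      (¬ (σ 27 ≤ n ∧ pL (σ 27) = X ∧ yv (σ 27) = Y) → σ' 29 = σ 29) := by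
  have hs := I.s_pos
  have h1 := I.lt_word
  have mm := I.mods_lt
  have pm := I.perm_lt
  obtain ⟨z, hz⟩ : ∃ z, z = σ 27 := ⟨_, rfl⟩
  rw [← hz]
  have e14 : σ 14 = start n pL (s * (X / s)) := hA 14 (by decide)
  have e15 : σ 15 = start n pL (s * (X / s + 1)) := hA 15 (by decide)
  unfold testProg
  refine runs_ite (fun hlo => runs_skip ⟨hA, hz.symm, rfl, fun ⟨h, hX, _⟩ => absurd hlo ?_,
    fun _ => rfl⟩) fun hlo => ?_
  · rw [← hz, e14, not_lt, start_le_iff F.left_mono h, hX]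
    exact Nat.mul_div_le X s
  refine runs_ite (fun hhi => ?_) fun hhi => runs_skip ⟨hA, hz.symm, rfl,
    fun ⟨h, hX, _⟩ => absurd ?_ hhi, fun _ => rfl⟩
  swap
  · rw [← hz, e15, ← not_le, start_le_iff F.left_mono h, hX, not_le]
    exact Nat.lt_mul_div_succ X hs
  rw [← hz, e14] at hlo
  rw [← hz, e15] at hhi
  have hzn : z ≤ n := by
    have := start_le n pL (s * (X / s + 1))
    omega
  rw [not_lt, start_le_iff F.left_mono hzn] at hlo
  rw [← not_le, start_le_iff F.left_mono hzn, not_le] at hhi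
  have bz : b * z ≤ b * (n + 1) := Nat.mul_le_mul_left _ (by omega)
  have cz : c * z ≤ c * (2 * n + 2) := Nat.mul_le_mul_left _ (by omega)
  refine runs_field (a := bM + c * z) (by decide) (by decide) (by decide)
    (by rw [hA 8 (by decide), hA 6 (by decide), ← hz]; rfl) (by omega)
    (by rw [hA 7 (by decide)]; exact I.c_lt)
    (by rw [hA 7 (by decide)]; exact Nat.two_pow_pos c) fun σ1 hv1 hf1 => ?_
  rw [hA 7 (by decide)] at hv1
  replace hv1 : σ1 32 = pL z % s := hv1.trans (I.mod_left z hzn)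
  have hA1 : Agree regs 23 σ1 := hA.frame fun r hr => hf1 r (by omega) (by omega)
  have z1 : σ1 27 = z := (hf1 27 (by decide) (by decide)).trans hz.symm
  have y1 : σ1 28 = σ 28 := hf1 28 (by decide) (by decide)
  have r1 : σ1 29 = σ 29 := hf1 29 (by decide) (by decide)
  have e13 : σ1 13 = X % s := hA1 13 (by decide)
  refine runs_ite (fun hne => runs_skip ⟨hA1, z1, y1, fun ⟨_, hX, _⟩ => absurd hne (by
    rw [hv1, e13, hX]; exact lt_irrefl _), fun _ => r1⟩) fun hge => ?_
  refine runs_ite (fun hne => runs_skip ⟨hA1, z1, y1, fun ⟨_, hX, _⟩ => absurd hne (by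
    rw [hv1, e13, hX]; exact lt_irrefl _), fun _ => r1⟩) fun hge' => ?_
  have hX : pL z = X := eq_of_block hs hlo hhi (by omega)
  refine runs_field (a := bP + b * z) (by decide) (by decide) (by decide)
    (by rw [hA1 4 (by decide), hA1 9 (by decide), z1]; rfl) (by omega)
    (by rw [hA1 5 (by decide)]; exact I.b_lt)
    (by rw [hA1 5 (by decide)]; exact Nat.two_pow_pos b) fun σ2 hv2 hf2 => ?_
  rw [hA1 5 (by decide)] at hv2
  replace hv2 : σ2 33 = P z := hv2.trans (I.perm z hzn)
  have hA2 : Agree regs 23 σ2 := hA1.frame fun r hr => hf2 r (by omega) (by omega)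
  have z2 : σ2 27 = z := (hf2 27 (by decide) (by decide)).trans z1
  have y2 : σ2 28 = σ 28 := (hf2 28 (by decide) (by decide)).trans y1
  have r2 : σ2 29 = σ 29 := (hf2 29 (by decide) (by decide)).trans r1
  have hPz := F.perm_le z
  have e20 : σ2 20 = start n pR (s * (P Y / s)) := hA2 20 (by decide)
  have e21 : σ2 21 = start n pR (s * (P Y / s + 1)) := hA2 21 (by decide)
  have pRz := F.right_perm z hzn
  refine runs_ite (fun hlo2 => runs_skip ⟨hA2, z2, y2, fun ⟨_, _, hy⟩ => absurd hlo2 (by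
    rw [hv2, e20, not_lt, start_le_iff F.right_mono hPz, pRz, hy]
    exact Nat.mul_div_le _ s), fun _ => r2⟩) fun hlo2 => ?_
  refine runs_ite (fun hhi2 => ?_) fun hhi2 => runs_skip ⟨hA2, z2, y2,
    fun ⟨_, _, hy⟩ => absurd (by
      rw [hv2, e21, ← not_le, start_le_iff F.right_mono hPz, pRz, hy, not_le]
      exact Nat.lt_mul_div_succ _ hs) hhi2, fun _ => r2⟩
  rw [hv2, e20, not_lt, start_le_iff F.right_mono hPz] at hlo2
  rw [hv2, e21, ← not_le, start_le_iff F.right_mono hPz, not_le] at hhi2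
  refine runs_op_seq ?_
  have e10 : σ2 10 = n + 1 := hA2 10 (by decide)
  rw [hv2, e10, Op.eval, Nat.mod_eq_of_lt (show P z + (n + 1) < 2 ^ w by omega)]
  have e34 : Function.update σ2 34 (P z + (n + 1)) 34 = P z + (n + 1) := Function.update_self ..
  have hA3 : Agree regs 23 (Function.update σ2 34 (P z + (n + 1))) := hA2.update (by decide)
  have z3 : Function.update σ2 34 (P z + (n + 1)) 27 = z := z2
  have y3 : Function.update σ2 34 (P z + (n + 1)) 28 = σ 28 := y2
  have r3 : Function.update σ2 34 (P z + (n + 1)) 29 = σ 29 := r2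
  generalize Function.update σ2 34 (P z + (n + 1)) = σ3 at e34 hA3 z3 y3 r3
  have cz : c * (n + 1 + P z) ≤ c * (2 * n + 2) := Nat.mul_le_mul_left _ (by omega)
  refine runs_field (a := bM + c * (n + 1 + P z)) (by decide) (by decide) (by decide)
    (by rw [hA3 8 (by decide), hA3 6 (by decide), e34, Nat.add_comm (P z)]; rfl) (by omega)
    (by rw [hA3 7 (by decide)]; exact I.c_lt)
    (by rw [hA3 7 (by decide)]; exact Nat.two_pow_pos c) fun σ4 hv4 hf4 => ?_
  rw [hA3 7 (by decide)] at hv4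
  replace hv4 : σ4 35 = pR (P z) % s := hv4.trans (I.mod_right _ hPz)
  have hA4 : Agree regs 23 σ4 := hA3.frame fun r hr => hf4 r (by omega) (by omega)
  have z4 : σ4 27 = z := (hf4 27 (by decide) (by decide)).trans z3
  have y4 : σ4 28 = σ 28 := (hf4 28 (by decide) (by decide)).trans y3
  have r4 : σ4 29 = σ 29 := (hf4 29 (by decide) (by decide)).trans r3
  have e19 : σ4 19 = P Y % s := hA4 19 (by decide)
  refine runs_ite (fun hne => runs_skip ⟨hA4, z4, y4, fun ⟨_, _, hy⟩ => absurd hne (by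
    rw [hv4, e19, pRz, hy]; exact lt_irrefl _), fun _ => r4⟩) fun hge2 => ?_
  refine runs_ite (fun hne => runs_skip ⟨hA4, z4, y4, fun ⟨_, _, hy⟩ => absurd hne (by
    rw [hv4, e19, pRz, hy]; exact lt_irrefl _), fun _ => r4⟩) fun hge2' => ?_
  have hPY : pR (P z) = P Y := eq_of_block hs hlo2 hhi2 (by omega)
  have hYz : yv z = Y := F.perm_inj _ _ (F.yv_le z) hY (pRz.symm.trans hPY)
  have e22 : σ4 22 = 0 := hA4 22 (by decide)
  refine runs_op ⟨hA4.update (by decide), z4, y4, fun _ => ?_, fun h => absurd ⟨hzn, hX, hYz⟩ h⟩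
  rw [Function.update_self, z4, e22]
  exact Nat.mod_eq_of_lt (show z < 2 ^ w by omega)

lemma runs_scanStep (I : IsIndex w mem n s b c bM bP pL pR P yv)
    (F : IsForestPair n k pL pR P yv) (A : IsAnswer n pL yv X Y ans) (hY : Y ≤ n)
    {m : ℕ} {σ : ℕ → ℕ} (hσ : ScanInv regs n ans (m + 1) σ) :
    Runs w mem (.seq testProg (.op .add 27 27 11)) σ 23 (ScanInv regs n ans m) := by
  obtain ⟨hA, hb, hm, h⟩ := hσ
  have h1 := I.lt_word
  refine Runs.seq (T := 22) (T' := 1) ((runs_test I F hY hA).mono le_rfl ?_)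
  rintro σ' ⟨hA', hz, he, hyes, hno⟩
  refine runs_op ⟨hA'.update (by decide), ?_⟩
  have e11 : σ' 11 = 1 := hA' 11 (by decide)
  have l : (σ 27 + 1) % 2 ^ w = σ 27 + 1 := Nat.mod_eq_of_lt (by omega)
  simp only [Function.update_self, Function.update_of_ne (show (28 : ℕ) ≠ 27 by decide),
    Function.update_of_ne (show (29 : ℕ) ≠ 27 by decide), Op.eval, e11, hz, he, l]
  refine ⟨hb, by omega, ?_⟩
  by_cases ht : σ 27 ≤ n ∧ pL (σ 27) = X ∧ yv (σ 27) = Y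
  · rw [hyes ht]
    exact Or.inl ((A.iff _ ht.1).1 ht.2).1
  · rw [hno ht]
    rcases h with h | ⟨h0, hle, hlt⟩
    · exact Or.inl h
    by_cases hza : σ 27 = ans
    · -- a candidate that is the answer passes the test, unless it is `0`
      rcases Nat.eq_zero_or_pos ans with ha | ha
      · exact Or.inl (h0.trans ha.symm)
      · exact absurd ⟨hza ▸ A.le, (A.iff _ (hza ▸ A.le)).2 ⟨hza, by omega⟩⟩ ht
    · exact Or.inr ⟨h0, by omega, hlt⟩

/-- The query program finds the answer, in time proportional to `log k + s`. -/
theorem runs_queryProg (I : IsIndex w mem n s b c bM bP pL pR P yv)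
    (F : IsForestPair n k pL pR P yv) (A : IsAnswer n pL yv X Y ans) (hX : X ≤ n) (hY : Y ≤ n) :
    Runs w mem queryProg (queryState X Y) (73 + Nat.size k * 12 + s * 24) fun σ => σ 0 = ans := by
  have h1 := I.lt_word
  have hans := A.le
  refine Runs.mono (T := 1 + (s * (23 + 1) + 1) + 4 + (Nat.size k * (11 + 1) + 1) + 5 + 35 + 26)
    ?_ (by omega) fun _ h => h
  unfold queryProg
  refine runs_loadHeader I fun σ1 h1 => runs_prepare I F hX hY h1 fun σ2 h2 =>
    runs_initSearch I F A h2 fun σ3 h3 => Runs.seq ?_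
  refine runs_loop (SearchInv regs n s ans) (fun m σ4 h4 hle => ?_) (fun σ4 h4 => ?_)
    (fun m σ4 h4 hlt => runs_searchStep I F A h4 hlt) _ h3
  swap
  · obtain ⟨-, -, -, -, -, h⟩ := h4
    omega
  refine runs_initScan I h4 hle fun σ5 h5 => Runs.seq ?_
  refine runs_loop (ScanInv regs n ans) (fun m σ6 h6 hle => ?_) (fun σ6 h6 => ?_)
    (fun m σ6 h6 _ => runs_scanStep I F A hY h6) _ h5
  swap
  · obtain ⟨-, -, h, -⟩ := h6
    omega
  obtain ⟨hA, -, hz, h⟩ := h6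
  have e22 : σ6 22 = 0 := hA 22 (by decide)
  have e29 : σ6 29 = ans := by
    rcases h with h | ⟨-, h, h'⟩
    · exact h
    · omega
  refine runs_op ?_
  rw [Function.update_self, e22, e29]
  exact Nat.mod_eq_of_lt (show ans < 2 ^ w by omega)

end Query

/-! ### Arrays of bit fields in the memory -/

section Fields

lemma toBits_length (f x : ℕ) : (toBits f x).length = f := by simp [toBits]

lemma flatMap_toBits_length (f : ℕ) (l : List ℕ) : (l.flatMap (toBits f)).length = f * l.length := by
  induction l with
  | nil => rfl
  | cons x l ih =>
    rw [List.flatMap_cons, List.length_append, ih, toBits_length, List.length_cons, Nat.mul_succ,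
      Nat.add_comm]

lemma flatMap_toBits_getD {f : ℕ} {l : List ℕ} {i j : ℕ} (hi : i < l.length) (hj : j < f) :
    (l.flatMap (toBits f)).getD (f * i + j) false = l[i].testBit j := by
  induction l generalizing i with
  | nil => simp at hi
  | cons x l ih =>
    rw [List.flatMap_cons]
    cases i with
    | zero =>
      rw [Nat.mul_zero, Nat.zero_add, List.getD_append _ _ _ _ (by rwa [toBits_length])]
      simp [toBits, List.getD_eq_getElem?_getD, hj]
    | succ i =>
      rw [List.getD_append_right _ _ _ _ (by rw [toBits_length, Nat.mul_succ]; omega),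
        toBits_length, show f * (i + 1) + j - f = f * i + j by rw [Nat.mul_succ]; omega,
        ih (by simpa using hi)]
      rfl

lemma sum_testBit (f x : ℕ) :
    (∑ j ∈ Finset.range f, if x.testBit j then 2 ^ j else 0) = x % 2 ^ f := by
  induction f with
  | zero => simp [Nat.mod_one]
  | succ f ih =>
    rw [Finset.sum_range_succ, ih, Nat.mod_pow_succ, Nat.testBit_eq_decide_div_mod_eq]
    rcases Nat.mod_two_eq_zero_or_one (x / 2 ^ f) with h | h <;> simp [h]

lemma readWord_lt (w : ℕ) (mem : List Bool) (a : ℕ) : readWord w mem a < 2 ^ w := by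
  have : readWord w mem a ≤ ∑ j ∈ Finset.range w, 2 ^ j :=
    Finset.sum_le_sum fun j _ => by split_ifs <;> simp
  have h := Nat.geomSum_lt (m := 2) (n := w) (s := Finset.range w) le_rfl (by simp)
  omega

lemma readWord_field {w f i : ℕ} {mem pre post : List Bool} {l : List ℕ} (hf : f ≤ w)
    (hmem : mem = pre ++ (l.flatMap (toBits f) ++ post)) (hi : i < l.length) (hl : l[i] < 2 ^ f) :
    readWord w mem (pre.length + f * i) % 2 ^ f = l[i] := by
  obtain ⟨e, rfl⟩ := Nat.exists_eq_add_of_le hf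
  have low : ∀ j ∈ Finset.range f,
      (if mem.getD (pre.length + f * i + j) false then 2 ^ j else 0) =
        if l[i].testBit j then 2 ^ j else 0 := by
    intro j hj
    rw [Finset.mem_range] at hj
    have h1 : f * i + j < f * l.length :=
      lt_of_lt_of_le (show f * i + j < f * (i + 1) by rw [Nat.mul_succ]; omega)
        (Nat.mul_le_mul_left f hi)
    rw [hmem, List.getD_append_right _ _ _ _ (by omega), List.getD_append _ _ _ _ (by
      rw [flatMap_toBits_length]; omega), show pre.length + f * i + j - pre.length = f * i + j by
      omega, flatMap_toBits_getD hi hj]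
  have high : 2 ^ f ∣ ∑ j ∈ Finset.range e,
      if mem.getD (pre.length + f * i + (f + j)) false then 2 ^ (f + j) else 0 :=
    Finset.dvd_sum fun j _ => by
      split_ifs
      · exact pow_dvd_pow 2 (Nat.le_add_right f j)
      · exact dvd_zero _
  obtain ⟨x, hx⟩ := high
  rw [readWord, Finset.sum_range_add, hx, Nat.add_mul_mod_self_left, Finset.sum_congr rfl low,
    sum_testBit, Nat.mod_mod, Nat.mod_eq_of_lt hl]

lemma readWord_word {w i : ℕ} {mem post : List Bool} {l : List ℕ}
    (hmem : mem = l.flatMap (toBits w) ++ post) (hi : i < l.length) (hl : l[i] < 2 ^ w) :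
    readWord w mem (w * i) = l[i] := by
  have := readWord_field (pre := []) le_rfl hmem hi hl
  rwa [List.length_nil, Nat.zero_add, Nat.mod_eq_of_lt (readWord_lt _ _ _)] at this

end Fields

/-! ### The index -/

section Index

/-- The word number `i` of the index: a header of nine words, followed by three words for every
sample `s * j`, namely the starts of its children in the two trees and its key. -/
def indexWord (w n s b c bM bP : ℕ) (pL pR yv : ℕ → ℕ) (i : ℕ) : ℕ :=
  if i < 9 then [w, s, b, 2 ^ b, c, 2 ^ c, bM, bP, n + 1].getD i 0
  else if (i - 9) % 3 = 0 then start n pL (s * ((i - 9) / 3))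
  else if (i - 9) % 3 = 1 then start n pR (s * ((i - 9) / 3))
  else pL (s * ((i - 9) / 3)) * (n + 1) + yv (s * ((i - 9) / 3))

/-- The parent numbers modulo `s`, first for the left and then for the right tree. -/
def indexMod (n s : ℕ) (pL pR : ℕ → ℕ) (z : ℕ) : ℕ :=
  if z ≤ n then pL z % s else pR (z - (n + 1)) % s

/-- The number of words of the index. -/
def numWords (n s : ℕ) : ℕ := 9 + 3 * (n / s + 2)

/-- The auxiliary index for a memory in which `r` bits separate it from the array of the
permutation. -/
def index (w n s b c r : ℕ) (pL pR yv : ℕ → ℕ) : List Bool :=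
  ((List.range (numWords n s)).map (indexWord w n s b c (w * numWords n s)
      (w * numWords n s + c * (2 * n + 2) + r) pL pR yv)).flatMap (toBits w) ++
    ((List.range (2 * n + 2)).map (indexMod n s pL pR)).flatMap (toBits c)

variable {w n s b c r : ℕ} {pL pR P yv : ℕ → ℕ}

lemma index_length : (index w n s b c r pL pR yv).length =
    w * numWords n s + c * (2 * n + 2) := by
  simp only [index, List.length_append, flatMap_toBits_length, List.length_map, List.length_range]

/-- The bounds on the parameters that keep all numbers below the word bound. -/
lemma word_bounds (hn : 1 ≤ n) (hs : s ≤ n + 1) (hr : r = 4 * n + 6) :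
    1 ≤ Nat.size n ∧ Nat.size s ≤ Nat.size n + 1 ∧
    (n + 1) * (n + 1) < 2 ^ (20 * Nat.size n) ∧
    20 * Nat.size n * (18 + 3 * n) < 2 ^ (20 * Nat.size n) ∧
    20 * Nat.size n * numWords n s + Nat.size s * (2 * n + 2) + r + Nat.size n * (n + 1) <
      2 ^ (20 * Nat.size n) ∧
    2 ^ Nat.size s < 2 ^ (20 * Nat.size n) ∧ 2 ^ Nat.size n < 2 ^ (20 * Nat.size n) := by
  have hb : 1 ≤ Nat.size n := Nat.size_pos.2 hn
  have hc : Nat.size s ≤ Nat.size n + 1 := by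
    rw [Nat.size_le, Nat.pow_succ]
    have := Nat.lt_size_self n
    omega
  have hnB : n + 1 ≤ 2 ^ Nat.size n := Nat.lt_size_self n
  have hbB : Nat.size n + 1 ≤ 2 ^ Nat.size n := Nat.lt_two_pow_self
  have hT : numWords n s ≤ 15 + 3 * n := by
    have := Nat.div_le_self n s
    unfold numWords
    omega
  -- all numbers are bounded by `512 B²` with `B = 2 ^ size n ≥ 2`, so `B ^ 20` is ample
  have big : 512 * (2 ^ Nat.size n * 2 ^ Nat.size n) < 2 ^ (20 * Nat.size n) := by
    rw [← Nat.pow_add, show 512 = 2 ^ 9 by norm_num, ← Nat.pow_add]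
    exact Nat.pow_lt_pow_right (by norm_num) (by omega)
  have c_lt : 2 ^ Nat.size s < 2 ^ (20 * Nat.size n) :=
    Nat.pow_lt_pow_right (by norm_num) (by omega)
  have b_lt : 2 ^ Nat.size n < 2 ^ (20 * Nat.size n) :=
    Nat.pow_lt_pow_right (by norm_num) (by omega)
  generalize 2 ^ (20 * Nat.size n) = W at *
  generalize 2 ^ Nat.size n = B at *
  have p1 : (n + 1) * (n + 1) ≤ B * B := Nat.mul_le_mul hnB hnB
  have p2 : Nat.size n * (n + 1) ≤ B * B := Nat.mul_le_mul (by omega) hnB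
  have p3 : Nat.size s * (n + 1) ≤ B * B := Nat.mul_le_mul (by omega) hnB
  have p4 : Nat.size n * numWords n s ≤ Nat.size n * (15 * (n + 1)) :=
    Nat.mul_le_mul_left _ (by omega)
  have p5 : n + 1 ≤ B * B := hnB.trans (Nat.le_mul_of_pos_left _ (by omega))
  have p6 : Nat.size n * (18 + 3 * n) ≤ Nat.size n * (18 * (n + 1)) :=
    Nat.mul_le_mul_left _ (by omega)
  rw [Nat.mul_left_comm] at p4 p6
  refine ⟨hb, hc, by omega, ?_, ?_, c_lt, b_lt⟩
  · rw [Nat.mul_assoc]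
    omega
  · rw [Nat.mul_assoc 20, show 2 * n + 2 = 2 * (n + 1) by omega, Nat.mul_left_comm (Nat.size s)]
    omega

/-- The memory with the index in front holds what the query program expects. -/
lemma isIndex_index {mem mid : List Bool} (hn : 1 ≤ n) (hs0 : 1 ≤ s) (hs : s ≤ n + 1)
    (hw : w = 20 * Nat.size n) (hb : b = Nat.size n) (hc : c = Nat.size s)
    (hr : r = 4 * n + 6) (hmid : mid.length = r)
    (hmem : mem = index w n s b c r pL pR yv ++
      (mid ++ ((List.range (n + 1)).map P).flatMap (toBits b)))
    (hL : ∀ z, pL z ≤ n) (hyv : ∀ z, yv z ≤ n) (hP : ∀ z, P z ≤ n) :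
    IsIndex w mem n s b c (w * numWords n s) (w * numWords n s + c * (2 * n + 2) + r)
      pL pR P yv := by
  obtain ⟨b1, b2, b3, b4, b5, b6, b7⟩ := word_bounds hn hs hr
  rw [← hc, ← hb] at b2
  rw [← hw, ← hc, ← hb] at b5
  rw [← hw] at b3 b4 b6 b7
  rw [← hc] at b6
  rw [← hb] at b1 b7
  have hns := Nat.div_le_self n s
  have hT : numWords n s = 9 + 3 * (n / s + 2) := rfl
  have n_lt : 18 + 3 * n < 2 ^ w :=
    lt_of_le_of_lt (Nat.le_mul_of_pos_left _ (by omega)) b4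
  have b_lt : b < 2 ^ b := Nat.lt_two_pow_self
  have c_lt : c < 2 ^ c := Nat.lt_two_pow_self
  have w_lt : w < 2 ^ w := Nat.lt_two_pow_self
  have word : ∀ i, i < numWords n s → indexWord w n s b c (w * numWords n s)
      (w * numWords n s + c * (2 * n + 2) + r) pL pR yv i < 2 ^ w →
      readWord w mem (w * i) = indexWord w n s b c (w * numWords n s)
        (w * numWords n s + c * (2 * n + 2) + r) pL pR yv i := by
    intro i hi hlt
    have h : mem = _ ++ _ := hmem.trans (List.append_assoc _ _ _)
    have := readWord_word (i := i) h (by simpa using hi) (by simpa using hlt)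
    simpa using this
  have field : ∀ z, z < 2 * n + 2 → readWord w mem (w * numWords n s + c * z) % 2 ^ c =
      indexMod n s pL pR z := by
    intro z hz
    have hlt : indexMod n s pL pR z < 2 ^ c := by
      have : s < 2 ^ c := hc ▸ Nat.lt_size_self s
      unfold indexMod
      split_ifs
      · exact (Nat.mod_lt _ hs0).trans this
      · exact (Nat.mod_lt _ hs0).trans this
    have h : mem = _ ++ (_ ++ _) := hmem.trans (List.append_assoc _ _ _)
    have := readWord_field (i := z) (w := w) (by omega) h (by simpa using hz) (by simpa using hlt)
    simpa only [flatMap_toBits_length, List.length_map, List.length_range, List.getElem_map,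
      List.getElem_range] using this
  have start_lt : ∀ f q, start n f q < 2 ^ w := fun f q => by
    have := start_le n f q
    omega
  have key_lt : ∀ z, pL z * (n + 1) + yv z < 2 ^ w := fun z => by
    have h1 := hyv z
    have h2 := Nat.mul_le_mul_right (n + 1) (hL z)
    rw [Nat.succ_mul] at b3
    omega
  refine ⟨?_, ?_, ?_, ?_, ?_, ?_, ?_, ?_, ?_, ?_, ?_, ?_, ?_, ?_, ?_, hs0, hs, by omega, b3, b4,
    by omega, by omega, b6, b7⟩
  · exact word 0 (by omega) w_lt
  · exact word 1 (by omega) (show s < 2 ^ w by omega)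
  · exact word 2 (by omega) (show b < 2 ^ w by omega)
  · exact word 3 (by omega) b7
  · exact word 4 (by omega) (show c < 2 ^ w by omega)
  · exact word 5 (by omega) b6
  · exact word 6 (by omega) (show w * numWords n s < 2 ^ w by omega)
  · exact word 7 (by omega) (show w * numWords n s + c * (2 * n + 2) + r < 2 ^ w by omega)
  · exact word 8 (by omega) (show n + 1 < 2 ^ w by omega)
  · intro j hj
    have e : indexWord w n s b c (w * numWords n s) (w * numWords n s + c * (2 * n + 2) + r)
        pL pR yv (9 + 3 * j) = start n pL (s * j) := by
      rw [indexWord, if_neg (by omega), if_pos (by omega), show (9 + 3 * j - 9) / 3 = j by omega]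
    rw [word _ (by omega) (e ▸ start_lt _ _), e]
  · intro j hj
    have e : indexWord w n s b c (w * numWords n s) (w * numWords n s + c * (2 * n + 2) + r)
        pL pR yv (10 + 3 * j) = start n pR (s * j) := by
      rw [indexWord, if_neg (by omega), if_neg (by omega), if_pos (by omega),
        show (10 + 3 * j - 9) / 3 = j by omega]
    rw [word _ (by omega) (e ▸ start_lt _ _), e]
  · intro j hj
    have hj' : j ≤ n / s := (Nat.le_div_iff_mul_le hs0).2 (by rwa [Nat.mul_comm])
    have e : indexWord w n s b c (w * numWords n s) (w * numWords n s + c * (2 * n + 2) + r)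
        pL pR yv (11 + 3 * j) = pL (s * j) * (n + 1) + yv (s * j) := by
      rw [indexWord, if_neg (by omega), if_neg (by omega), if_neg (by omega),
        show (11 + 3 * j - 9) / 3 = j by omega]
    rw [word _ (by omega) (e ▸ key_lt _), e]
  · intro z hz
    rw [field z (by omega), indexMod, if_pos hz]
  · intro z hz
    rw [field (n + 1 + z) (by omega), indexMod, if_neg (by omega), Nat.add_sub_cancel_left]
  · intro z hz
    have hlt : P z < 2 ^ b := (hP z).trans_lt (hb ▸ Nat.lt_size_self n)
    have h : mem = (index w n s b c r pL pR yv ++ mid) ++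
        (((List.range (n + 1)).map P).flatMap (toBits b) ++ []) := by
      rw [hmem, List.append_nil, List.append_assoc]
    have := readWord_field (i := z) (w := w) (by omega) h (by simp; omega) (by simpa using hlt)
    simpa [index_length, hmid] using this

end Index

/-! ### The index of a grammar -/

namespace Grammar

variable {n : ℕ} (G : Grammar n)

/-- The name of the left child of a node, which is the level-order number of its parent in the left
tree. -/
def leftNum (z : ℕ) : ℕ := parentOf G.leftParent (Fin.ofNat (n + 1) z)

/-- The name of the right child of a node. -/
def rightName (z : ℕ) : ℕ := parentOf G.rightParent (Fin.ofNat (n + 1) z)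

/-- The level-order number in the right tree of the node with the name `z`. -/
def permNum (z : ℕ) : ℕ := (order G.rightParent).idxOf (Fin.ofNat (n + 1) z)

/-- The parent function of the right tree on level-order numbers. -/
def rightNum (p : ℕ) : ℕ :=
  (order G.rightParent).idxOf (parentOf G.rightParent ((order G.rightParent).getD p 0))

lemma length_order_right : (order G.rightParent).length = n + 1 := by
  simpa using (order_perm G.wf_right).length_eq

lemma perm_eq {G : Grammar n} (hG : G.SortedNames) :
    G.perm = (List.range (n + 1)).map G.permNum := by
  have h : G.perm = (order G.leftParent).map fun v => (order G.rightParent).idxOf v := rfl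
  rw [h, hG.order_eq]
  refine List.ext_getElem (by simp) fun i h1 h2 => ?_
  simp only [List.length_map, List.length_finRange] at h1
  simp only [List.getElem_map, List.getElem_finRange, List.getElem_range, permNum]
  congr 1
  exact Fin.ext (by simp [Nat.mod_eq_of_lt h1])

lemma isForestPair {G : Grammar n} (hG : G.SortedNames) :
    IsForestPair n G.maxDegree G.leftNum G.rightNum G.permNum G.rightName where
  left_mono y z hyz hz := hG.left_mono (by
    rw [Fin.le_def]
    simp only [Fin.val_ofNat]
    rwa [Nat.mod_eq_of_lt (by omega), Nat.mod_eq_of_lt (by omega)])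
  right_mono y z hyz hz := by
    rcases hyz.lt_or_eq with hlt | rfl
    · have h := List.pairwise_iff_getElem.1 (idxOf_parentOf_mono (q := G.rightParent)) y z
        (by rw [length_order_right]; omega) (by rw [length_order_right]; omega) hlt
      rwa [← List.getD_eq_getElem _ 0, ← List.getD_eq_getElem _ 0] at h
    · rfl
  left_le z := Fin.is_le _
  yv_le z := Fin.is_le _
  perm_le z := by
    have := List.idxOf_lt_length_iff.2 (mem_order G.wf_right (Fin.ofNat (n + 1) z))
    rw [length_order_right] at this
    exact Nat.le_of_lt_succ this
  perm_inj y z hy hz h := by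
    have := congrArg Fin.val ((List.idxOf_inj (mem_order G.wf_right _)).1 h)
    simpa only [Fin.val_ofNat, Nat.mod_eq_of_lt (Nat.lt_succ_of_le hy),
      Nat.mod_eq_of_lt (Nat.lt_succ_of_le hz)] using this
  right_perm z hz := by
    have hm := List.idxOf_lt_length_iff.2 (mem_order G.wf_right (Fin.ofNat (n + 1) z))
    unfold rightNum permNum rightName
    rw [List.getD_eq_getElem _ _ hm, List.getElem_idxOf]
    congr 1
    exact Fin.ext (by simp)
  yv_mono y z hyz hz h := hG.right_mono (by
    rw [Fin.le_def]
    simp only [Fin.val_ofNat]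
    rwa [Nat.mod_eq_of_lt (by omega), Nat.mod_eq_of_lt (by omega)]) (Fin.ext h)
  degree q := by
    refine le_trans ?_ (G.card_children_le (Fin.ofNat (n + 1) q))
    refine le_trans (Finset.card_le_card (t := (Finset.univ.filter fun Z : Fin n =>
      G.leftParent Z = Fin.ofNat (n + 1) q).image fun Z : Fin n => (Z : ℕ) + 1) ?_) Finset.card_image_le
    intro z hz
    simp only [Finset.mem_filter, Finset.mem_Icc] at hz
    obtain ⟨⟨h1, h2⟩, h3⟩ := hz
    refine Finset.mem_image.2 ⟨⟨z - 1, by omega⟩, ?_, by simp; omega⟩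
    simp only [Finset.mem_filter, Finset.mem_univ, true_and]
    have e : Fin.ofNat (n + 1) z = Fin.succ ⟨z - 1, by omega⟩ :=
      Fin.ext (by simp [Nat.mod_eq_of_lt (Nat.lt_succ_of_le h2)]; omega)
    rw [leftNum, e, parentOf_succ] at h3
    refine Fin.ext ?_
    rw [h3, Fin.val_ofNat, Nat.mod_eq_of_lt (by rw [← h3]; exact Fin.is_lt _)]

lemma isAnswer (X Y : Fin n) :
    IsAnswer n G.leftNum G.rightName (node X : ℕ) (node Y : ℕ) (answer (G.reverseDict X Y)) where
  le := by
    cases G.reverseDict X Y with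
    | none => exact Nat.zero_le n
    | some Z => exact Fin.is_le _
  iff z hz := by
    have h := G.parents_iff_answer (u := Fin.ofNat (n + 1) z) (X := X) (Y := Y)
    have e : ((Fin.ofNat (n + 1) z : Fin (n + 1)) : ℕ) = z := by
      rw [Fin.val_ofNat, Nat.mod_eq_of_lt (by omega)]
    rw [Ne, Fin.ext_iff, Fin.ext_iff, Fin.ext_iff, e] at h
    exact h

/-- The auxiliary index of a grammar with one sample for every `s` nodes. -/
def aux (s : ℕ) : List Bool :=
  index (20 * Nat.size n) n s (Nat.size n) (Nat.size s) (4 * n + 6) G.leftNum G.rightNum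
    G.rightName

lemma length_mem {G : Grammar n} (hG : G.SortedNames) (s : ℕ) :
    (G.aux s ++ G.representation).length =
      20 * Nat.size n * numWords n s + Nat.size s * (2 * n + 2) +
        (4 * n + 6 + Nat.size n * (n + 1)) := by
  rw [List.length_append, aux, index_length, representation, List.length_append,
    List.length_append, leftChildren_eq, rightChildren_eq, louds_length G.wf_left,
    louds_length G.wf_right, flatMap_toBits_length, perm_eq hG, List.length_map,
    List.length_range]
  omega

/-- A query takes time proportional to `log k + s`. -/
theorem runs_query {G : Grammar n} (hG : G.SortedNames) {s : ℕ} (hs0 : 1 ≤ s) (hs : s ≤ n + 1)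
    (X Y : Fin n) :
    Runs (20 * Nat.size n) (G.aux s ++ G.representation) queryProg
      (queryState (node X : ℕ) (node Y : ℕ)) (73 + Nat.size G.maxDegree * 12 + s * 24)
      fun σ => σ 0 = answer (G.reverseDict X Y) := by
  have F := isForestPair hG
  have I : IsIndex (20 * Nat.size n) (G.aux s ++ G.representation) n s (Nat.size n) (Nat.size s)
      _ _ G.leftNum G.rightNum G.permNum G.rightName :=
    isIndex_index (by have := X.is_lt; omega) hs0 hs rfl rfl rfl rfl
      (mid := louds G.leftChildren 0 (n + 1) ++ louds G.rightChildren 0 (n + 1))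
      (by
        rw [List.length_append, leftChildren_eq, rightChildren_eq, louds_length G.wf_left,
          louds_length G.wf_right]
        omega)
      (by rw [← perm_eq hG]; rfl) F.left_le F.yv_le F.perm_le
  exact runs_queryProg I F (G.isAnswer X Y) (Fin.is_le _) (Fin.is_le _)

end Grammar

/-! ### Space and time -/

open Filter

lemma size_le_logb {n : ℕ} (hn : 1 ≤ n) : (Nat.size n : ℝ) ≤ Real.logb 2 n + 1 := by
  obtain ⟨m, hm⟩ := Nat.exists_eq_add_of_lt (Nat.size_pos.2 hn)
  have h : 2 ^ m ≤ n := Nat.lt_size.1 (by omega)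
  have : (m : ℝ) ≤ Real.logb 2 n := by
    rw [Real.le_logb_iff_rpow_le (by norm_num) (by exact_mod_cast hn), Real.rpow_natCast]
    exact_mod_cast h
  rw [hm]
  push_cast
  linarith

lemma logb_le_self {n : ℕ} (hn : 1 ≤ n) : Real.logb 2 n ≤ n := by
  rw [Real.logb_le_iff_le_rpow (by norm_num) (by exact_mod_cast hn), Real.rpow_natCast]
  exact_mod_cast Nat.lt_two_pow_self.le

/-- The sampling distance: proportional to `1 / ε`, so that the samples take at most
`(ε / 4) n log n` bits, and at most `n + 1`, so that it fits into a word. -/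
noncomputable def sampling (ε : ℝ) (n : ℕ) : ℕ := min ⌈240 / ε⌉₊ (n + 1)

/-- The length of the memory. -/
noncomputable def memLength (ε : ℝ) (n : ℕ) : ℕ :=
  20 * Nat.size n * numWords n (sampling ε n) + Nat.size (sampling ε n) * (2 * n + 2) +
    (4 * n + 6 + Nat.size n * (n + 1))

/-- For large `n`, the terms of order `n` are smaller than `ε n log n`. -/
lemma memLength_le {ε : ℝ} (hε : 0 < ε) :
    ∀ᶠ n : ℕ in atTop, (memLength ε n : ℝ) ≤ (1 + ε) * n * Real.logb 2 n + 4 * n := by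
  set S := ⌈240 / ε⌉₊ with hS
  have hSε : 240 / ε ≤ S := Nat.le_ceil _
  have hS0 : (0 : ℝ) < S := lt_of_lt_of_le (by positivity) hSε
  have lim : Tendsto (fun n : ℕ => Real.logb 2 n) atTop atTop :=
    (Real.tendsto_logb_atTop (by norm_num)).comp tendsto_natCast_atTop_atTop
  filter_upwards [eventually_ge_atTop 1, eventually_ge_atTop S,
    lim.eventually_ge_atTop ((1000 + ε + 4 * Nat.size S) * (4 / (3 * ε)))] with n hn hnS hL
  have hs : sampling ε n = S := min_eq_left (by omega)
  have hb := size_le_logb hn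
  have hb0 : (0 : ℝ) ≤ Nat.size n := Nat.cast_nonneg _
  have hLn := logb_le_self hn
  have hn1 : (1 : ℝ) ≤ n := by exact_mod_cast hn
  have hL0 : 0 ≤ Real.logb 2 n := Real.logb_nonneg (by norm_num) hn1
  have hdiv : 60 * ((n / S : ℕ) : ℝ) ≤ ε / 4 * n := by
    have h1 : ((n / S : ℕ) : ℝ) ≤ n / S := Nat.cast_div_le
    have h2 : (n : ℝ) / S ≤ n / (240 / ε) := by gcongr
    have h3 : (n : ℝ) / (240 / ε) = ε * n / 240 := by field_simp
    linarith
  have hK : (1000 + ε + 4 * Nat.size S) ≤ 3 * ε / 4 * Real.logb 2 n := by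
    have h := mul_le_mul_of_nonneg_left hL (show 0 ≤ 3 * ε / 4 by positivity)
    have e : 3 * ε / 4 * ((1000 + ε + 4 * Nat.size S) * (4 / (3 * ε))) =
        1000 + ε + 4 * Nat.size S := by field_simp
    rwa [e] at h
  rw [memLength, hs, numWords]
  push_cast
  generalize Real.logb 2 n = L at *
  generalize (Nat.size n : ℝ) = b at *
  generalize (n : ℝ) = x at *
  generalize ((n / S : ℕ) : ℝ) = d at *
  have hc : (0 : ℝ) ≤ Nat.size S := Nat.cast_nonneg _
  generalize (Nat.size S : ℝ) = c at *
  -- the words, and the permutation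
  have t1 : 20 * b * (9 + 3 * (d + 2)) ≤ (L + 1) * (300 + ε / 4 * x) := by
    have : 20 * b * (9 + 3 * (d + 2)) = b * (300 + 60 * d) := by ring
    rw [this]
    have hx : 0 ≤ ε / 4 * x := by positivity
    calc b * (300 + 60 * d) ≤ b * (300 + ε / 4 * x) := by
          exact mul_le_mul_of_nonneg_left (by linarith) hb0
      _ ≤ _ := mul_le_mul_of_nonneg_right hb (by positivity)
  have t2 : b * (x + 1) ≤ (L + 1) * (x + 1) := mul_le_mul_of_nonneg_right hb (by linarith)
  have t3 := mul_le_mul_of_nonneg_right hK (show 0 ≤ x by linarith)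
  have t4 : c ≤ c * x := le_mul_of_one_le_right hc hn1
  have t5 : 0 ≤ ε * x := by positivity
  nlinarith

/-- The error term of the space bound, which vanishes for large `n`. -/
noncomputable def excess (ε : ℝ) (n : ℕ) : ℝ :=
  max 0 (memLength ε n - ((1 + ε) * n * Real.logb 2 n + 4 * n))

lemma excess_isLittleO {ε : ℝ} (hε : 0 < ε) :
    excess ε =o[atTop] (fun n : ℕ => (n : ℝ)) := by
  refine (Asymptotics.isLittleO_zero (fun n : ℕ => (n : ℝ)) atTop).congr' ?_ .rfl
  filter_upwards [memLength_le hε] with n hn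
  exact (max_eq_left (by linarith)).symm

/-- The time bound: both the logarithm of the degree and the sampling distance are bounded by
`(1 / ε) log (k + 1)` up to a constant. -/
lemma time_le {ε : ℝ} (hε : 0 < ε) (hε1 : ε < 1) {n k t : ℕ} (hk : 1 ≤ k)
    (ht : t ≤ 73 + Nat.size k * 12 + sampling ε n * 24) :
    (t : ℝ) ≤ 6000 * (1 / ε) * Real.logb 2 (k + 1) := by
  have hk1 : (1 : ℝ) ≤ k := by exact_mod_cast hk
  have hl : 1 ≤ Real.logb 2 (k + 1) := by
    rw [Real.le_logb_iff_rpow_le (by norm_num) (by linarith), Real.rpow_one]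
    linarith
  have hsize : (Nat.size k : ℝ) ≤ Real.logb 2 (k + 1) + 1 :=
    (size_le_logb hk).trans (by
      gcongr
      · norm_num
      · linarith)
  have hinv : 1 ≤ 1 / ε := by
    rw [le_div_iff₀ hε]
    linarith
  have hs : (sampling ε n : ℝ) ≤ 241 * (1 / ε) := by
    have h1 : (sampling ε n : ℝ) ≤ ⌈240 / ε⌉₊ := by exact_mod_cast min_le_left _ _
    have h2 := Nat.ceil_lt_add_one (show 0 ≤ 240 / ε by positivity)
    have h3 : 240 / ε = 240 * (1 / ε) := by ring
    linarith
  have ht' : (t : ℝ) ≤ 73 + Nat.size k * 12 + sampling ε n * 24 := by exact_mod_cast ht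
  generalize Real.logb 2 (k + 1) = l at *
  generalize 1 / ε = e at *
  have h1 : e ≤ e * l := le_mul_of_one_le_right (by linarith) hl
  have h2 : l ≤ e * l := le_mul_of_one_le_left (by linarith) hinv
  linarith

end ESPIndex

theorem lemma5 :
    -- word length `a * ⌈log₂ (n + 1)⌉`, the query program, and the constant of the time bound
    ∃ (a : ℕ) (prog : ESPIndex.Prog) (C : ℝ),
      ∀ ε : ℝ, 0 < ε → ε < 1 →
        ∃ δ : ℕ → ℝ, δ =o[Filter.atTop] (fun n : ℕ => (n : ℝ)) ∧
          ∀ (n : ℕ) (G : ESPIndex.Grammar n), G.SortedNames →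
            G.maxDegree ≤ n ∧
            ∃ aux : List Bool,
              (((aux ++ G.representation).length : ℕ) : ℝ)
                  ≤ (1 + ε) * n * Real.logb 2 n + 4 * n + δ n ∧
              ∀ X Y : Fin n, ∃ (t : ℕ) (s : ℕ → ℕ),
                ESPIndex.Exec (a * Nat.size n) (aux ++ G.representation) prog
                  (ESPIndex.queryState (ESPIndex.Grammar.node X : ℕ)
                    (ESPIndex.Grammar.node Y : ℕ)) t s ∧
                s 0 = ESPIndex.answer (G.reverseDict X Y) ∧
                (t : ℝ) ≤ C * (1 / ε) * Real.logb 2 (G.maxDegree + 1) ∧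
                (t : ℝ) ≤ C * (1 / ε) * Real.logb 2 (n + 1) := by
  refine ⟨20, ESPIndex.queryProg, 6000, fun ε hε hε1 =>
    ⟨ESPIndex.excess ε, ESPIndex.excess_isLittleO hε, fun n G hG =>
      ⟨G.maxDegree_le, G.aux (ESPIndex.sampling ε n), ?_, fun X Y => ?_⟩⟩⟩
  · have h : (ESPIndex.memLength ε n : ℝ) - ((1 + ε) * n * Real.logb 2 n + 4 * n) ≤
        ESPIndex.excess ε n := le_max_right _ _
    rw [ESPIndex.Grammar.length_mem hG]
    change (ESPIndex.memLength ε n : ℝ) ≤ _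
    linarith
  · have hs : 1 ≤ ESPIndex.sampling ε n :=
      le_min (Nat.one_le_ceil_iff.2 (by positivity)) (by omega)
    obtain ⟨t, σ, hexec, ht, hσ⟩ := ESPIndex.Grammar.runs_query hG hs (min_le_right _ _) X Y
    have hk := G.one_le_maxDegree X
    have time := ESPIndex.time_le hε hε1 hk ht
    refine ⟨t, σ, hexec, hσ, time, time.trans ?_⟩
    have h0 : (0 : ℝ) < G.maxDegree + 1 := by positivity
    have h1 : (G.maxDegree : ℝ) ≤ n := by exact_mod_cast G.maxDegree_le
    gcongr
    norm_num
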